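/- Setting. Let $\mathcal Y$ be a compact metric space, $\mathcal V,\mathcal U\subset\mathbb R^d$ compact, $\tau>0$ and $c(v,u)=\tau\|v-u\|_2^2$. Let $\Psi_1,\Psi_2:[0,\infty)\to(-\infty,\infty]$ be convex and lower semicontinuous with $\Psi_i(1)=0$, and suppose that the conjugates $\Psi_i^*(s)=\sup_{x\ge0}(sx-\Psi_i(x))$ are finite and differentiable on $\mathbb R$. For measures $\alpha,\beta$ with Lebesgue decomposition $\alpha=\alpha_{ac}+\alpha^\perp$ with respect to $\beta$, put $D_{\Psi}(\alpha\|\beta)=\int\Psi\big(\tfrac{d\alpha_{ac}}{d\beta}\big)\,d\beta+\alpha^\perp(X)\lim_{x\to\infty}\Psi(x)/x$, where $X$ is the whole space. Let $\eta$ and $\nu$ be Borel probability measures on $\mathcal Y\times\mathcal V$ and $\mathcal Y\times\mathcal U$ with $\eta_Y=\nu_Y$. A plan is a finite positive Borel measure $\pi$ on $(\mathcal Y\times\mathcal V)\times(\mathcal Y\times\mathcal U)$, concentrated on $\{(y,v,y',u): y=y'\}$, of the form $\pi(\cdot|y)\,\eta_Y(dy)$ with positive measures $\pi(\cdot|y)$.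 Its marginals on $\mathcal Y\times\mathcal V$ and $\mathcal Y\times\mathcal U$ are $\pi_1=\pi_1(\cdot|y)\,\eta_Y(dy)$ and $\pi_2=\pi_2(\cdot|y)\,\eta_Y(dy)$. An optimal CUOT plan is a plan that minimizes $$\int c\,d\pi+\int_{\mathcal Y}D_{\Psi_1}(\pi_1(\cdot|y)\|\eta(\cdot|y))\,d\eta_Y(y)+\int_{\mathcal Y}D_{\Psi_2}(\pi_2(\cdot|y)\|\nu(\cdot|y))\,d\nu_Y(y)$$ over all plans. For $\varphi\in C(\mathcal Y\times\mathcal U)$ let $\varphi^c(y,v)=\inf_{u\in\mathcal U}[c(v,u)-\varphi(y,u)]$. Let $\varphi^\star\in C(\mathcal Y\times\mathcal U)$ be an optimal semi-dual potential, that is, a maximizer over $C(\mathcal Y\times\mathcal U)$ of $$\varphi\mapsto\int-\Psi_1^*(-\varphi^c)\,d\eta+\int-\Psi_2^*(-\varphi)\,d\nu .$$ Put $d\tilde\eta=(\Psi_1^*)'(-(\varphi^\star)^c)\,d\eta$ and $d\tilde\nu=(\Psi_2^*)'(-\varphi^\star)\,d\nu$. Theorem. (1) There is a measurable triangular map $(y,v)\mapsto(y,T^\star(y,v))$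 with $T^\star(y,v)\in\operatorname{argmin}_{u\in\mathcal U}[c(v,u)-\varphi^\star(y,u)]$, and hence $(\varphi^\star)^c(y,v)=c(v,T^\star(y,v))-\varphi^\star(y,T^\star(y,v))$, for $\eta$-almost every $(y,v)$. If $\eta(\cdot|y)$ is absolutely continuous with respect to Lebesgue measure for $\eta_Y$-almost every $y$, this map is optimal: among all measurable triangular maps $(y,v)\mapsto(y,S(y,v))$ that push $\tilde\eta$ forward to $\tilde\nu$ (it is one of them), it minimizes $\int c(v,S(y,v))\,d\tilde\eta(y,v)$, and the optimal CUOT plan is the image of $\tilde\eta$ under $(y,v)\mapsto\big((y,v),(y,T^\star(y,v))\big)$. (2) For every $\varphi\in C(\mathcal Y\times\mathcal U)$, every $(y,v)$ and every $u\in\mathcal U$: $u\in\operatorname{argmin}_{u'\in\mathcal U}[c(v,u')-\varphi(y,u')]$ if and only if $\varphi^c(y,v)=c(v,u)-\varphi(y,u)$; and there is a measurable $T_\varphi:\mathcal Y\times\mathcal V\to\mathcal U$ with $\varphi^c(y,v)=c(v,T_\varphi(y,v))-\varphi(y,T_\varphi(y,v))$ for $\eta$-almost every $(y,v)$. (3)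 An optimal CUOT plan exists. Every optimal CUOT plan $\pi^\star$ has the marginals $\pi^\star_1=\tilde\eta$ and $\pi^\star_2=\tilde\nu$, and $$\tau\,\big(\mathcal W_2^{\nu_Y}\big)^2(\eta,\nu)\;\ge\;\int_{\mathcal Y}D_{\Psi_1}(\tilde\eta(\cdot|y)\|\eta(\cdot|y))\,d\nu_Y(y)+\int_{\mathcal Y}D_{\Psi_2}(\tilde\nu(\cdot|y)\|\nu(\cdot|y))\,d\nu_Y(y),$$ where $(\mathcal W_2^{\nu_Y})^2(\eta,\nu)=\int_{\mathcal Y}\mathcal W_2^2(\eta(\cdot|y),\nu(\cdot|y))\,d\nu_Y(y)$ and $\mathcal W_2$ is the 2-Wasserstein distance. If $\pi^\star$ is the image of $\pi^\star_1$ under $(y,v)\mapsto((y,v),(y,S(y,v)))$ with $S$ measurable, then $S(y,v)\in\operatorname{argmin}_{u\in\mathcal U}[c(v,u)-\varphi^\star(y,u)]$ for $\pi_1^\star$-almost every $(y,v)$. (4) The same inequality, with $\pi_1,\pi_2$ in place of $\tilde\eta,\tilde\nu$, holds for the marginals of every plan $\pi$ that is optimal among the plans with $\pi_Y=\eta_Y$,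 that is, with $\pi(\cdot|y)$ a probability measure for almost every $y$. -/

import Mathlib

open MeasureTheory ProbabilityTheory Set Filter
open scoped ENNReal NNReal

noncomputable section

/-- The extended-real integral `∫ f⁺ dμ - ∫ f⁻ dμ`. In this file it is only applied to functions
whose negative part has finite integral. -/
def eintegral {α : Type*} [MeasurableSpace α] (μ : Measure α) (f : α → EReal) : EReal :=
  ((∫⁻ x, (f x).toENNReal ∂μ : ℝ≥0∞) : EReal) - ((∫⁻ x, (-f x).toENNReal ∂μ : ℝ≥0∞) : EReal)

/-! ### Entropy functions and Csiszár divergences -/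

/-- Entropy functions: convex, lower semicontinuous functions `Ψ : [0, ∞) → (-∞, ∞]`
with `Ψ 1 = 0`. -/
structure IsEntropy (Ψ : ℝ≥0 → EReal) : Prop where
  ne_bot : ∀ x, Ψ x ≠ ⊥
  convex : ∀ x y a b : ℝ≥0, a + b = 1 →
    Ψ (a * x + b * y) ≤ ((a : ℝ) : EReal) * Ψ x + ((b : ℝ) : EReal) * Ψ y
  lsc : LowerSemicontinuous Ψ
  one : Ψ 1 = 0

/-- The Legendre-Fenchel conjugate `Ψ*(s) = sup_{x ≥ 0} (s x - Ψ x)`. -/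
def conj (Ψ : ℝ≥0 → EReal) (s : ℝ) : EReal :=
  ⨆ x : ℝ≥0, (((s * (x : ℝ) : ℝ) : EReal) - Ψ x)

/-- The conjugate as a real function; to be used when `Ψ*` is finite everywhere. -/
def conjReal (Ψ : ℝ≥0 → EReal) (s : ℝ) : ℝ := (conj Ψ s).toReal

/-- `Ψ*` is a finite, differentiable function on `ℝ`. -/
def HasDiffConj (Ψ : ℝ≥0 → EReal) : Prop :=
  (∀ s, conj Ψ s ≠ ⊤) ∧ Differentiable ℝ (conjReal Ψ)

/-- The recession constant `Ψ'_∞ = lim_{x → ∞} Ψ x / x` (for a convex `Ψ` the limit exists). -/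
def recession (Ψ : ℝ≥0 → EReal) : EReal :=
  limsup (fun x : ℝ≥0 => Ψ x / ((x : ℝ) : EReal)) atTop

/-- The Csiszár divergence `D_Ψ(α ‖ β)`. -/
def csiszar {X : Type*} [MeasurableSpace X] (Ψ : ℝ≥0 → EReal) (α β : Measure X) : EReal :=
  eintegral β (fun x => Ψ (α.rnDeriv β x).toNNReal)
    + recession Ψ * ((α.singularPart β univ : ℝ≥0∞) : EReal)

/-! ### Wasserstein distances -/

/-- The 2-Wasserstein distance, with values in `[0, ∞]`. -/
def W2 {E : Type*} [NormedAddCommGroup E] [MeasurableSpace E] (α β : Measure E) : ℝ≥0∞ :=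
  (⨅ γ : {γ : Measure (E × E) // γ.fst = α ∧ γ.snd = β},
    ∫⁻ q, ENNReal.ofReal (‖q.1 - q.2‖ ^ 2) ∂γ.1) ^ (1 / 2 : ℝ)

section Cond

variable {Y : Type*} [MeasurableSpace Y] {d : ℕ}

/-- The conditional 2-Wasserstein distance of `η` and `ν`, measures on `Y × ℝ^d` with the same
`Y`-marginal `μ`: the `L²(μ)`-norm of `y ↦ W2 (η(·|y)) (ν(·|y))`. -/
def condW2 (μ : Measure Y) (η ν : Measure (Y × EuclideanSpace ℝ (Fin d)))
    [IsFiniteMeasure η] [IsFiniteMeasure ν] : ℝ≥0∞ :=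
  (∫⁻ y, W2 (η.condKernel y) (ν.condKernel y) ^ 2 ∂μ) ^ (1 / 2 : ℝ)

/-! ### The conditional unbalanced optimal transport problem -/

/-- The quadratic cost `c(v, u) = τ ‖v - u‖²`. -/
def qcost (τ : ℝ) (v u : EuclideanSpace ℝ (Fin d)) : ℝ := τ * ‖v - u‖ ^ 2

/-- The conditional measure `α(·|y)` of a finite measure `α` on `Y × ℝ^d` whose `Y`-marginal is
absolutely continuous with respect to `μ`: the family with `α(dy, dx) = α(dx|y) μ(dy)`.
It has total mass `dα_Y/dμ (y)`, so it is a probability measure if `α_Y = μ`. -/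
def condMeasure (μ : Measure Y) (α : Measure (Y × EuclideanSpace ℝ (Fin d)))
    [IsFiniteMeasure α] (y : Y) : Measure (EuclideanSpace ℝ (Fin d)) :=
  (α.fst.rnDeriv μ y) • α.condKernel y

/-- The integrated divergence `∫ D_Ψ(α(·|y) ‖ β(·|y)) dμ(y)`. -/
def condDiv (Ψ : ℝ≥0 → EReal) (μ : Measure Y) (α β : Measure (Y × EuclideanSpace ℝ (Fin d)))
    [IsFiniteMeasure α] [IsFiniteMeasure β] : EReal :=
  eintegral μ (fun y => csiszar Ψ (condMeasure μ α y) (β.condKernel y))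

/-- Transport plans: finite positive measures on `(Y × V) × (Y × U)`, concentrated on the
diagonal `y = y'`, which disintegrate as `π(·|y) μ(dy)`, with `π(·|y)` a positive measure. -/
structure IsPlan (μ : Measure Y) (V U : Set (EuclideanSpace ℝ (Fin d)))
    (π : Measure ((Y × EuclideanSpace ℝ (Fin d)) × (Y × EuclideanSpace ℝ (Fin d)))) : Prop where
  finite : IsFiniteMeasure π
  diag : ∀ᵐ q ∂π, q.1.1 = q.2.1
  source : ∀ᵐ q ∂π, q.1.2 ∈ V
  target : ∀ᵐ q ∂π, q.2.2 ∈ U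
  marginal : π.fst.fst ≪ μ

/-- The objective of the conditional unbalanced optimal transport problem. -/
def cuotObjective (τ : ℝ) (Ψ₁ Ψ₂ : ℝ≥0 → EReal) (η ν : Measure (Y × EuclideanSpace ℝ (Fin d)))
    [IsFiniteMeasure η] [IsFiniteMeasure ν]
    (π : Measure ((Y × EuclideanSpace ℝ (Fin d)) × (Y × EuclideanSpace ℝ (Fin d))))
    [IsFiniteMeasure π] : EReal :=
  ((∫⁻ q, ENNReal.ofReal (qcost τ q.1.2 q.2.2) ∂π : ℝ≥0∞) : EReal)
    + condDiv Ψ₁ η.fst π.fst η + condDiv Ψ₂ ν.fst π.snd ν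

/-- `π` is an optimal plan of the conditional unbalanced optimal transport problem. -/
def IsOptimalPlan (τ : ℝ) (Ψ₁ Ψ₂ : ℝ≥0 → EReal) (V U : Set (EuclideanSpace ℝ (Fin d)))
    (η ν : Measure (Y × EuclideanSpace ℝ (Fin d))) [IsFiniteMeasure η] [IsFiniteMeasure ν]
    (π : Measure ((Y × EuclideanSpace ℝ (Fin d)) × (Y × EuclideanSpace ℝ (Fin d))))
    [IsFiniteMeasure π] : Prop :=
  IsPlan η.fst V U π ∧
    ∀ (π' : Measure ((Y × EuclideanSpace ℝ (Fin d)) × (Y × EuclideanSpace ℝ (Fin d))))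
      [IsFiniteMeasure π'], IsPlan η.fst V U π' →
      cuotObjective τ Ψ₁ Ψ₂ η ν π ≤ cuotObjective τ Ψ₁ Ψ₂ η ν π'

/-- `π` is optimal among the plans whose `Y`-marginal is exactly `η_Y`, i.e. whose conditional
plans `π(·|y)` are probability measures. -/
def IsOptimalBalancedPlan (τ : ℝ) (Ψ₁ Ψ₂ : ℝ≥0 → EReal) (V U : Set (EuclideanSpace ℝ (Fin d)))
    (η ν : Measure (Y × EuclideanSpace ℝ (Fin d))) [IsFiniteMeasure η] [IsFiniteMeasure ν]
    (π : Measure ((Y × EuclideanSpace ℝ (Fin d)) × (Y × EuclideanSpace ℝ (Fin d))))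
    [IsFiniteMeasure π] : Prop :=
  (IsPlan η.fst V U π ∧ π.fst.fst = η.fst) ∧
    ∀ (π' : Measure ((Y × EuclideanSpace ℝ (Fin d)) × (Y × EuclideanSpace ℝ (Fin d))))
      [IsFiniteMeasure π'], IsPlan η.fst V U π' → π'.fst.fst = η.fst →
      cuotObjective τ Ψ₁ Ψ₂ η ν π ≤ cuotObjective τ Ψ₁ Ψ₂ η ν π'

/-! ### The semi-dual problem -/

/-- The conditional `c`-transform `φ^c(y, v) = inf_{u ∈ U} (c(v, u) - φ(y, u))`. -/
def cTransform (τ : ℝ) (U : Set (EuclideanSpace ℝ (Fin d)))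
    (φ : Y × EuclideanSpace ℝ (Fin d) → ℝ) (p : Y × EuclideanSpace ℝ (Fin d)) : ℝ :=
  ⨅ u : U, (qcost τ p.2 (u : EuclideanSpace ℝ (Fin d)) - φ (p.1, (u : EuclideanSpace ℝ (Fin d))))

/-- The semi-dual objective. -/
def semiDual (τ : ℝ) (Ψ₁ Ψ₂ : ℝ≥0 → EReal) (U : Set (EuclideanSpace ℝ (Fin d)))
    (η ν : Measure (Y × EuclideanSpace ℝ (Fin d)))
    (φ : Y × EuclideanSpace ℝ (Fin d) → ℝ) : ℝ :=
  (∫ p, -conjReal Ψ₁ (-cTransform τ U φ p) ∂η) + ∫ p, -conjReal Ψ₂ (-φ p) ∂ν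

/-- `φ` is a potential: a continuous function on `Y × U` (its values elsewhere are irrelevant). -/
def IsPotential [TopologicalSpace Y] (U : Set (EuclideanSpace ℝ (Fin d)))
    (φ : Y × EuclideanSpace ℝ (Fin d) → ℝ) : Prop :=
  ContinuousOn φ (univ ×ˢ U)

/-- `φ` attains the supremum in the semi-dual problem. -/
def IsOptimalPotential [TopologicalSpace Y] (τ : ℝ) (Ψ₁ Ψ₂ : ℝ≥0 → EReal)
    (U : Set (EuclideanSpace ℝ (Fin d))) (η ν : Measure (Y × EuclideanSpace ℝ (Fin d)))
    (φ : Y × EuclideanSpace ℝ (Fin d) → ℝ) : Prop :=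
  IsPotential U φ ∧
    ∀ ψ, IsPotential U ψ → semiDual τ Ψ₁ Ψ₂ U η ν ψ ≤ semiDual τ Ψ₁ Ψ₂ U η ν φ

/-- `dη̃ = Ψ₁*'(-φ^c) dη`. -/
def etaTilde (τ : ℝ) (Ψ₁ : ℝ≥0 → EReal) (U : Set (EuclideanSpace ℝ (Fin d)))
    (η : Measure (Y × EuclideanSpace ℝ (Fin d))) (φ : Y × EuclideanSpace ℝ (Fin d) → ℝ) :
    Measure (Y × EuclideanSpace ℝ (Fin d)) :=
  η.withDensity (fun p => ENNReal.ofReal (deriv (conjReal Ψ₁) (-cTransform τ U φ p)))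

/-- `dν̃ = Ψ₂*'(-φ) dν`. -/
def nuTilde (Ψ₂ : ℝ≥0 → EReal)
    (ν : Measure (Y × EuclideanSpace ℝ (Fin d))) (φ : Y × EuclideanSpace ℝ (Fin d) → ℝ) :
    Measure (Y × EuclideanSpace ℝ (Fin d)) :=
  ν.withDensity (fun p => ENNReal.ofReal (deriv (conjReal Ψ₂) (-φ p)))

/-! ### Triangular maps -/

/-- The triangular map `(y, v) ↦ (y, T(y, v))`. -/
def tri (T : Y × EuclideanSpace ℝ (Fin d) → EuclideanSpace ℝ (Fin d))
    (p : Y × EuclideanSpace ℝ (Fin d)) : Y × EuclideanSpace ℝ (Fin d) := (p.1, T p)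

/-- `u ∈ argmin_{u ∈ U} (c(v, u) - φ(y, u))`, where `p = (y, v)`. -/
def IsArgmin (τ : ℝ) (U : Set (EuclideanSpace ℝ (Fin d)))
    (φ : Y × EuclideanSpace ℝ (Fin d) → ℝ) (p : Y × EuclideanSpace ℝ (Fin d))
    (u : EuclideanSpace ℝ (Fin d)) : Prop :=
  u ∈ U ∧ IsMinOn (fun u' => qcost τ p.2 u' - φ (p.1, u')) U u

/-- The triangular map of `T` solves the conditional Monge problem from `α` to `β`. -/
def IsMongeOptimal (τ : ℝ) (α β : Measure (Y × EuclideanSpace ℝ (Fin d)))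
    (T : Y × EuclideanSpace ℝ (Fin d) → EuclideanSpace ℝ (Fin d)) : Prop :=
  (Measurable T ∧ α.map (tri T) = β) ∧
    ∀ S : Y × EuclideanSpace ℝ (Fin d) → EuclideanSpace ℝ (Fin d),
      Measurable S → α.map (tri S) = β →
      ∫⁻ p, ENNReal.ofReal (qcost τ p.2 (T p)) ∂α ≤ ∫⁻ p, ENNReal.ofReal (qcost τ p.2 (S p)) ∂α

end Cond

end

/-!
The unbalanced problem is solved by convex duality, with all fibres `y` treated at once.

*Divergences.* As the conjugates `Ψᵢ*` are finite, `Ψᵢ` is superlinear, so a plan of finite objective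
has marginals that are absolutely continuous, fibrewise and jointly
(`condKernel_ac_of_condDiv_ne_top`), and the integrated conditional divergence equals
`∫ Ψᵢ(ρ)` for the joint density `ρ` (`condDiv_eq_eintegral`). The Fenchel-Young inequality then
integrates to `∫ s dα - ∫ Ψ*(s) dβ ≤ D`, and since `Ψ*` is differentiable, equality holds exactly for
`dα = Ψ*'(s) dβ` (`fenchel_young_condDiv`, `condDiv_conjDensity`).

*Weak duality.* The cost of a plan is the integral of `φ^c` and `φ` against its marginals plus the
integral of the nonnegative slack `c - φ^c - φ`. Together with Fenchel-Young for `s = -φ^c` and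
`s = -φ`, the objective is at least the semi-dual value, and equality forces the marginals to be the
reweighted measures and the plan to live where the slack vanishes, that is, on the minimizers
(`IsPlan.semiDual_le`).

*Existence.* At an optimal `φ`, the derivative of the semi-dual objective towards a competitor says
that `(φ^c, φ)` solves the balanced Kantorovich dual problem between the reweighted measures
(`IsOptimalPotential.dual_le`). Kantorovich duality on the compact fibre product `Y × V × U`, proved
with the Hahn-Banach and Riesz-Markov-Kakutani theorems (`exists_coupling_of_dual_le`), then gives a
plan between these measures with zero slack, which attains the semi-dual value.

*Maps.* Minimizers are selected measurably (`exists_measurable_isArgmin`). The `c`-transform is a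
Lipschitz function of `v` plus `τ ‖v‖²`, so by Rademacher's theorem it is differentiable almost
everywhere; where it is, its gradient determines the minimizer. With absolutely continuous
conditionals a plan without slack is therefore induced by the selection.

*The divergence bound.* For an optimal plan the divergences are at most the semi-dual value, which is
at most `∫ φ^c dη + ∫ φ dν` because `s ≤ Ψᵢ*(s)`, and the easy half of Kantorovich duality in each
fibre bounds this by the squared conditional Wasserstein distance. For plans with `π_Y = η_Y` there
is no such potential; instead, Kantorovich duality between `η` and `ν` provides a competitor with
vanishing divergences whose cost is at most that distance. No measurable selection of fibrewise
optimal couplings is needed in either case.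
-/

/-! ### Entropy functions and their conjugates -/

namespace IsEntropy

variable {Ψ : ℝ≥0 → EReal}

lemma le_conj (hΨ : IsEntropy Ψ) (s : ℝ) : (s : EReal) ≤ conj Ψ s := by
  refine le_trans ?_ (le_iSup _ (1 : ℝ≥0))
  simp [hΨ.one]

lemma coe_conjReal (hΨ : IsEntropy Ψ) (h : HasDiffConj Ψ) (s : ℝ) :
    ((conjReal Ψ s : ℝ) : EReal) = conj Ψ s :=
  EReal.coe_toReal (h.1 s) fun hb => by simpa [hb] using hΨ.le_conj s

lemma le_conjReal (hΨ : IsEntropy Ψ) (h : HasDiffConj Ψ) (s : ℝ) : s ≤ conjReal Ψ s := by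
  have := hΨ.le_conj s
  rw [← hΨ.coe_conjReal h] at this
  exact_mod_cast this

/-- The Fenchel-Young inequality. -/
lemma fenchel_young (hΨ : IsEntropy Ψ) (h : HasDiffConj Ψ) (s : ℝ) (x : ℝ≥0) :
    ((s * x - conjReal Ψ s : ℝ) : EReal) ≤ Ψ x := by
  have h1 : ((s * (x : ℝ) : ℝ) : EReal) - Ψ x ≤ (conjReal Ψ s : ℝ) := by
    rw [hΨ.coe_conjReal h]
    exact le_iSup (fun x : ℝ≥0 => (((s * (x : ℝ) : ℝ) : EReal) - Ψ x)) x
  induction hx : Ψ x with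
  | bot => exact absurd hx (hΨ.ne_bot x)
  | top => exact le_top
  | coe r =>
    rw [hx] at h1
    have h2 : s * x - r ≤ conjReal Ψ s := by exact_mod_cast h1
    have h3 : s * x - conjReal Ψ s ≤ r := by linarith
    exact_mod_cast h3

lemma neg_abs_le (hΨ : IsEntropy Ψ) (h : HasDiffConj Ψ) (x : ℝ≥0) :
    ((-|conjReal Ψ 0| : ℝ) : EReal) ≤ Ψ x := by
  refine le_trans ?_ (hΨ.fenchel_young h 0 x)
  rw [EReal.coe_le_coe_iff]
  linarith [le_abs_self (conjReal Ψ 0)]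

lemma conjReal_le (hΨ : IsEntropy Ψ) (h : HasDiffConj Ψ) {s b : ℝ}
    (hb : ∀ (x : ℝ≥0) (r : ℝ), Ψ x = r → s * x - r ≤ b) : conjReal Ψ s ≤ b := by
  have h1 : conj Ψ s ≤ b := by
    refine iSup_le fun x => ?_
    induction hx : Ψ x with
    | bot => exact absurd hx (hΨ.ne_bot x)
    | top => simp
    | coe r => exact_mod_cast hb x r hx
  rw [← hΨ.coe_conjReal h] at h1
  exact_mod_cast h1

lemma fenchel_young_real (hΨ : IsEntropy Ψ) (h : HasDiffConj Ψ) (s : ℝ) {x : ℝ≥0} {r : ℝ}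
    (hr : Ψ x = r) : s * x - r ≤ conjReal Ψ s := by
  have := hΨ.fenchel_young h s x
  rw [hr] at this
  have h3 : s * x - conjReal Ψ s ≤ r := by exact_mod_cast this
  linarith

lemma convexOn_conjReal (hΨ : IsEntropy Ψ) (h : HasDiffConj Ψ) :
    ConvexOn ℝ univ (conjReal Ψ) := by
  refine ⟨convex_univ, fun s _ t _ a b ha hb hab => hΨ.conjReal_le h fun x r hr => ?_⟩
  have h1 := mul_le_mul_of_nonneg_left (hΨ.fenchel_young_real h s hr) ha
  have h2 := mul_le_mul_of_nonneg_left (hΨ.fenchel_young_real h t hr) hb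
  simp only [smul_eq_mul]
  obtain rfl : b = 1 - a := by linarith
  nlinarith

lemma monotone_conjReal (hΨ : IsEntropy Ψ) (h : HasDiffConj Ψ) : Monotone (conjReal Ψ) := by
  refine fun s t hst => hΨ.conjReal_le h fun x r hr => ?_
  have h1 := hΨ.fenchel_young_real h t hr
  have h2 := mul_le_mul_of_nonneg_right hst x.2
  simp only [NNReal.val_eq_coe] at h2
  linarith

lemma deriv_conjReal_nonneg (hΨ : IsEntropy Ψ) (h : HasDiffConj Ψ) (s : ℝ) :
    0 ≤ deriv (conjReal Ψ) s :=
  (hΨ.monotone_conjReal h).deriv_nonneg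

lemma monotone_deriv_conjReal (hΨ : IsEntropy Ψ) (h : HasDiffConj Ψ) :
    Monotone (deriv (conjReal Ψ)) := by
  have := (hΨ.convexOn_conjReal h).monotoneOn_deriv (fun x _ => h.2 x)
  exact fun s t hst => this (mem_univ s) (mem_univ t) hst

/-- Equality in the Fenchel-Young inequality determines the point, as the conjugate is
differentiable. -/
lemma eq_deriv_of_fenchel_eq (hΨ : IsEntropy Ψ) (h : HasDiffConj Ψ) {s : ℝ} {x : ℝ≥0}
    (hx : Ψ x = ((s * x - conjReal Ψ s : ℝ) : EReal)) : (x : ℝ) = deriv (conjReal Ψ) s := by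
  have hmin : IsLocalMin (fun t => conjReal Ψ t - t * x) s := by
    refine Filter.Eventually.of_forall fun t => ?_
    have := hΨ.fenchel_young_real h t hx
    simp only
    linarith
  have hd : HasDerivAt (fun t => conjReal Ψ t - t * x) (deriv (conjReal Ψ) s - 1 * x) s :=
    (h.2 s).hasDerivAt.sub ((hasDerivAt_id s).mul_const (x : ℝ))
  have := hmin.hasDerivAt_eq_zero hd
  linarith

/-- The derivative of the conjugate attains the supremum that defines the conjugate. The supremum
is attained somewhere since `Ψ` is lower semicontinuous and superlinear. -/
lemma apply_deriv_conjReal (hΨ : IsEntropy Ψ) (h : HasDiffConj Ψ) (s : ℝ) :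
    Ψ (deriv (conjReal Ψ) s).toNNReal =
      ((s * deriv (conjReal Ψ) s - conjReal Ψ s : ℝ) : EReal) := by
  suffices H : ∃ x : ℝ≥0, Ψ x = ((s * x - conjReal Ψ s : ℝ) : EReal) by
    obtain ⟨x, hx⟩ := H
    rw [← hΨ.eq_deriv_of_fenchel_eq h hx, Real.toNNReal_coe]
    exact hx
  have hlsc : LowerSemicontinuous fun x : ℝ≥0 => Ψ x + ((-(s * x) : ℝ) : EReal) := by
    refine LowerSemicontinuous.add' hΨ.lsc (Continuous.lowerSemicontinuous ?_) fun x => ?_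
    · exact continuous_coe_real_ereal.comp (by fun_prop)
    · exact EReal.continuousAt_add (.inr (EReal.coe_ne_bot _)) (.inr (EReal.coe_ne_top _))
  -- beyond `R` the values of `s x - Ψ x` are below the value at `1`
  set R : ℝ≥0 := (conjReal Ψ (s + 1) - s).toNNReal + 1 with hR
  obtain ⟨x, -, hx⟩ := LowerSemicontinuousOn.exists_isMinOn (s := Icc 0 R)
    ⟨0, by simp⟩ isCompact_Icc (hlsc.lowerSemicontinuousOn _)
  have hmin : ∀ y, Ψ x + ((-(s * x) : ℝ) : EReal) ≤ Ψ y + ((-(s * y) : ℝ) : EReal) := by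
    intro y
    by_cases hy : y ≤ R
    · exact hx ⟨zero_le, hy⟩
    · refine (hx (a := 1) ⟨zero_le, by simp [hR]⟩).trans ?_
      have h1 := hΨ.fenchel_young h (s + 1) y
      simp only [hΨ.one]
      refine le_trans ?_ (add_le_add_left h1 _)
      have h2 : conjReal Ψ (s + 1) - s ≤ y := by
        refine (Real.le_coe_toNNReal _).trans ?_
        have : ((conjReal Ψ (s + 1) - s).toNNReal : ℝ) + 1 ≤ y := by
          exact_mod_cast (not_le.1 hy).le
        linarith
      rw [zero_add, ← EReal.coe_add, EReal.coe_le_coe_iff]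
      simp only [NNReal.coe_one, mul_one]
      linarith
  have hle : ∀ y (r : ℝ), Ψ y = r → Ψ x + ((-(s * x) : ℝ) : EReal) ≤ ((r - s * y : ℝ) : EReal) := by
    intro y r hr
    have := hmin y
    rwa [hr, ← EReal.coe_add, ← sub_eq_add_neg] at this
  refine ⟨x, le_antisymm ?_ (hΨ.fenchel_young h s x)⟩
  induction hx' : Ψ x with
  | bot => exact absurd hx' (hΨ.ne_bot x)
  | top =>
    have := hle 1 0 (by simp [hΨ.one])
    rw [hx', EReal.top_add_coe] at this
    exact absurd this (not_le.2 (EReal.coe_lt_top _))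
  | coe r =>
    have : conjReal Ψ s ≤ s * x - r := by
      refine hΨ.conjReal_le h fun y r' hr' => ?_
      have := hle y r' hr'
      rw [hx', ← EReal.coe_add, EReal.coe_le_coe_iff] at this
      linarith
    rw [EReal.coe_le_coe_iff]
    linarith

/-- As the conjugate is finite everywhere, the entropy function is superlinear. -/
lemma recession_eq_top (hΨ : IsEntropy Ψ) (h : HasDiffConj Ψ) : recession Ψ = ⊤ := by
  rw [EReal.eq_top_iff_forall_lt]
  intro s
  have key : ∀ᶠ x : ℝ≥0 in atTop, ((s + 1 : ℝ) : EReal) ≤ Ψ x / ((x : ℝ) : EReal) := by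
    filter_upwards [eventually_ge_atTop (max 1 (conjReal Ψ (s + 2)).toNNReal)] with x hx
    have hx1 : (1 : ℝ) ≤ x := by exact_mod_cast (le_max_left _ _).trans hx
    have hx2 : conjReal Ψ (s + 2) ≤ x := (Real.le_coe_toNNReal _).trans
      (by exact_mod_cast (le_max_right _ _).trans hx)
    have hx0 : (0 : EReal) < ((x : ℝ) : EReal) := by exact_mod_cast (by linarith : (0 : ℝ) < x)
    rw [EReal.le_div_iff_mul_le hx0 (EReal.coe_ne_top _), ← EReal.coe_mul]
    refine le_trans ?_ (hΨ.fenchel_young h (s + 2) x)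
    rw [EReal.coe_le_coe_iff]
    nlinarith
  refine lt_of_lt_of_le (EReal.coe_lt_coe_iff.2 (lt_add_one s)) ?_
  exact le_limsup_of_frequently_le' key.frequently

end IsEntropy

/-! ### Extended integrals -/

section EIntegral

variable {α : Type*} [MeasurableSpace α]

lemma eintegral_congr_ae {μ : Measure α} {f g : α → EReal} (h : f =ᵐ[μ] g) :
    eintegral μ f = eintegral μ g := by
  unfold eintegral
  rw [lintegral_congr_ae (h.mono fun x hx => by simp only [hx] :
      (fun x => (f x).toENNReal) =ᵐ[μ] fun x => (g x).toENNReal),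
    lintegral_congr_ae (h.mono fun x hx => by simp only [hx] :
      (fun x => (-f x).toENNReal) =ᵐ[μ] fun x => (-g x).toENNReal)]

lemma toENNReal_neg_le {a : EReal} {M : ℝ} (h : ((-M : ℝ) : EReal) ≤ a) :
    (-a).toENNReal ≤ ENNReal.ofReal M := by
  rw [← EReal.toReal_coe M, ← EReal.toENNReal_of_ne_top (EReal.coe_ne_top M)]
  refine EReal.toENNReal_le_toENNReal ?_
  rw [EReal.neg_le, ← EReal.coe_neg]
  exact h

lemma lintegral_toENNReal_neg_le {μ : Measure α} [IsProbabilityMeasure μ] {f : α → EReal} {M : ℝ}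
    (h : ∀ x, ((-M : ℝ) : EReal) ≤ f x) :
    ∫⁻ x, (-f x).toENNReal ∂μ ≤ ENNReal.ofReal M := by
  refine (lintegral_mono fun x => toENNReal_neg_le (h x)).trans ?_
  simp

/-- For functions bounded from below, the extended integral is the Lebesgue integral of a shift
of the function. -/
lemma eintegral_add_const {μ : Measure α} [IsProbabilityMeasure μ] {f : α → EReal} {M : ℝ}
    (hM : 0 ≤ M) (hf : AEMeasurable f μ) (h : ∀ x, ((-M : ℝ) : EReal) ≤ f x) :
    eintegral μ f + M = ((∫⁻ x, (f x + M).toENNReal ∂μ : ℝ≥0∞) : EReal) := by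
  have hpt : ∀ x, (f x + M).toENNReal + (-f x).toENNReal = (f x).toENNReal + ENNReal.ofReal M := by
    intro x
    have := h x
    induction hx : f x with
    | bot => rw [hx] at this; exact absurd this (not_le.2 (EReal.bot_lt_coe _))
    | top => simp
    | coe r =>
      rw [hx, EReal.coe_le_coe_iff] at this
      rw [← EReal.coe_add, ← EReal.coe_neg]
      simp only [EReal.toENNReal_of_ne_top (EReal.coe_ne_top _), EReal.toReal_coe]
      rcases le_total 0 r with hr | hr
      · rw [ENNReal.ofReal_of_nonpos (by linarith : -r ≤ 0), ENNReal.ofReal_add hr hM, add_zero]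
      · rw [ENNReal.ofReal_of_nonpos hr, ← ENNReal.ofReal_add (by linarith) (by linarith)]
        simp
  have hint : (∫⁻ x, (f x + M).toENNReal ∂μ) + ∫⁻ x, (-f x).toENNReal ∂μ
      = (∫⁻ x, (f x).toENNReal ∂μ) + ENNReal.ofReal M := by
    have hneg : AEMeasurable (fun x => (-f x).toENNReal) μ := hf.neg.ereal_toENNReal
    rw [← lintegral_add_right' _ hneg,
      lintegral_congr hpt, lintegral_add_right _ measurable_const]
    simp
  have hfin := (lintegral_toENNReal_neg_le (μ := μ) h).trans_lt ENNReal.ofReal_lt_top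
  unfold eintegral
  set A := ∫⁻ x, (f x + M).toENNReal ∂μ
  set B := ∫⁻ x, (-f x).toENNReal ∂μ
  set C := ∫⁻ x, (f x).toENNReal ∂μ
  lift B to ℝ≥0 using hfin.ne with B'
  by_cases hC : C = ∞
  · have hA : A = ∞ := by
      rw [hC, top_add] at hint
      by_contra hA
      exact ENNReal.add_ne_top.2 ⟨hA, ENNReal.coe_ne_top⟩ hint
    rw [hC, hA]
    simp
  · lift C to ℝ≥0 using hC with C'
    have hA : A ≠ ∞ := fun hA => by
      rw [hA, top_add] at hint
      exact ENNReal.add_ne_top.2 ⟨ENNReal.coe_ne_top, ENNReal.ofReal_ne_top⟩ hint.symm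
    lift A to ℝ≥0 using hA with A'
    have h2 := congrArg ENNReal.toReal hint
    rw [ENNReal.toReal_add ENNReal.coe_ne_top ENNReal.coe_ne_top,
      ENNReal.toReal_add ENNReal.coe_ne_top ENNReal.ofReal_ne_top, ENNReal.toReal_ofReal hM] at h2
    simp only [ENNReal.coe_toReal] at h2
    have : ((C' : ℝ) - B' + M : ℝ) = A' := by linarith
    simp only [EReal.coe_nnreal_eq_coe_real]
    rw [← this, EReal.coe_add, EReal.coe_sub]

lemma neg_le_eintegral {μ : Measure α} [IsProbabilityMeasure μ] {f : α → EReal} {M : ℝ}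
    (hM : 0 ≤ M) (h : ∀ x, ((-M : ℝ) : EReal) ≤ f x) :
    ((-M : ℝ) : EReal) ≤ eintegral μ f := by
  unfold eintegral
  have h1 : ((∫⁻ x, (-f x).toENNReal ∂μ : ℝ≥0∞) : EReal) ≤ (M : EReal) := by
    refine (EReal.coe_ennreal_le_coe_ennreal_iff.2 (lintegral_toENNReal_neg_le (μ := μ) h)).trans ?_
    rw [EReal.coe_ennreal_ofReal, max_eq_left hM]
  refine le_trans ?_ (EReal.sub_le_sub (EReal.coe_ennreal_nonneg _) h1)
  simp

lemma eintegral_coe {μ : Measure α} {f : α → EReal} {g : α → ℝ} (hg : Integrable g μ)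
    (h : ∀ᵐ x ∂μ, f x = g x) : eintegral μ f = ((∫ x, g x ∂μ : ℝ) : EReal) := by
  rw [eintegral_congr_ae h, integral_eq_lintegral_pos_part_sub_lintegral_neg_part hg]
  unfold eintegral
  have h1 : ∀ x, ((g x : ℝ) : EReal).toENNReal = ENNReal.ofReal (g x) := fun x => by
    simp [EReal.toENNReal_of_ne_top]
  have h2 : ∀ x, (-((g x : ℝ) : EReal)).toENNReal = ENNReal.ofReal (-g x) := fun x => by
    rw [← EReal.coe_neg, EReal.toENNReal_of_ne_top (EReal.coe_ne_top _), EReal.toReal_coe]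
  simp only [h1, h2]
  rw [EReal.coe_sub, EReal.coe_ennreal_toReal, EReal.coe_ennreal_toReal]
  · exact hg.neg.lintegral_lt_top.ne
  · exact hg.lintegral_lt_top.ne

lemma integrable_toReal_of_eintegral_ne_top {μ : Measure α} [IsProbabilityMeasure μ]
    {f : α → EReal} {M : ℝ} (hf : Measurable f)
    (h : ∀ x, ((-M : ℝ) : EReal) ≤ f x) (hfin : eintegral μ f ≠ ⊤) :
    Integrable (fun x => (f x).toReal) μ ∧ ∀ᵐ x ∂μ, f x = ((f x).toReal : ℝ) := by
  have hneg := (lintegral_toENNReal_neg_le (μ := μ) h).trans_lt ENNReal.ofReal_lt_top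
  have hpos : ∫⁻ x, (f x).toENNReal ∂μ < ∞ := by
    refine lt_top_iff_ne_top.2 fun htop => hfin ?_
    unfold eintegral
    lift ∫⁻ x, (-f x).toENNReal ∂μ to ℝ≥0 using hneg.ne with B
    rw [htop]
    rfl
  have hbot : ∀ x, f x ≠ ⊥ := fun x hx => by
    have := h x
    rw [hx] at this
    exact absurd this (not_le.2 (EReal.bot_lt_coe _))
  have hae : ∀ᵐ x ∂μ, f x = ((f x).toReal : ℝ) := by
    filter_upwards [ae_lt_top hf.ereal_toENNReal hpos.ne] with x hx
    refine (EReal.coe_toReal (fun htop => ?_) (hbot x)).symm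
    simp [htop] at hx
  refine ⟨⟨hf.ereal_toReal.aestronglyMeasurable, ?_⟩, hae⟩
  rw [hasFiniteIntegral_iff_norm]
  have hle : ∀ᵐ x ∂μ, ENNReal.ofReal ‖(f x).toReal‖ ≤ (f x).toENNReal + (-f x).toENNReal := by
    filter_upwards [hae] with x hx
    rw [hx, ← EReal.coe_neg]
    simp only [EReal.toENNReal_of_ne_top (EReal.coe_ne_top _), EReal.toReal_coe]
    rcases le_total 0 (f x).toReal with hr | hr
    · rw [Real.norm_of_nonneg hr]; exact le_self_add
    · rw [Real.norm_of_nonpos hr]; exact le_add_self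
  refine (lintegral_mono_ae hle).trans_lt ?_
  rw [lintegral_add_left hf.ereal_toENNReal]
  exact ENNReal.add_lt_top.2 ⟨hpos, hneg⟩

end EIntegral

/-! ### Disintegration of the divergence -/

section CondDivergence

variable {Y : Type*} [MeasurableSpace Y] {d : ℕ} {Ψ : ℝ≥0 → EReal}

/-- A joint density, built from the density of the `Y`-marginal and the kernel Radon-Nikodym
derivative. The kernel version of the derivative is jointly measurable, and it is this that makes
the conditional divergences measurable in `y`. -/
lemma exists_density_of_condKernel_ac (α β : Measure (Y × EuclideanSpace ℝ (Fin d)))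
    [IsFiniteMeasure α] [IsFiniteMeasure β] (hac : α.fst ≪ β.fst)
    (hk : ∀ᵐ y ∂α.fst, α.condKernel y ≪ β.condKernel y) :
    ∃ ρ : Y × EuclideanSpace ℝ (Fin d) → ℝ≥0∞, Measurable ρ ∧ α = β.withDensity ρ ∧
      ∀ᵐ y ∂β.fst, condMeasure β.fst α y = (β.condKernel y).withDensity fun x => ρ (y, x) := by
  set r := α.fst.rnDeriv β.fst
  have hr : Measurable r := Measure.measurable_rnDeriv _ _
  have hαr : α.fst = β.fst.withDensity r := (Measure.withDensity_rnDeriv_eq _ _ hac).symm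
  set k : Y × EuclideanSpace ℝ (Fin d) → ℝ≥0∞ :=
    fun p => Kernel.rnDeriv α.condKernel β.condKernel p.1 p.2
  have hkm : Measurable k := Kernel.measurable_rnDeriv _ _
  have hρ : Measurable fun p : Y × EuclideanSpace ℝ (Fin d) => r p.1 * k p :=
    (hr.comp measurable_fst).mul hkm
  have hcond : ∀ᵐ y ∂β.fst, condMeasure β.fst α y
      = (β.condKernel y).withDensity fun x => r y * k (y, x) := by
    rw [hαr, ae_withDensity_iff hr] at hk
    filter_upwards [hk] with y hy
    have hsec : Measurable fun x => k (y, x) := hkm.comp measurable_prodMk_left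
    change r y • α.condKernel y = _
    by_cases h0 : r y = 0
    · simp [h0]
    · have h1 : α.condKernel y = (β.condKernel y).withDensity fun x => k (y, x) := by
        rw [← Measure.withDensity_rnDeriv_eq _ _ (hy h0)]
        exact withDensity_congr_ae Kernel.rnDeriv_eq_rnDeriv_measure.symm
      rw [h1, ← withDensity_smul _ hsec]
      rfl
  refine ⟨_, hρ, ?_, hcond⟩
  ext s hs
  have hs' : ∀ y, MeasurableSet (Prod.mk y ⁻¹' s) := fun y => measurable_prodMk_left hs
  rw [withDensity_apply _ hs, ← lintegral_indicator hs,
    ← Measure.lintegral_condKernel (hρ.indicator hs)]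
  have hm : Measurable fun y => α.condKernel y {x | (y, x) ∈ s} :=
    Kernel.measurable_kernel_prodMk_left hs
  rw [← Measure.lintegral_condKernel_mem hs, hαr, lintegral_withDensity_eq_lintegral_mul _ hr hm]
  refine lintegral_congr_ae ?_
  filter_upwards [hcond] with y hy
  have h2 := congrArg (fun m => m (Prod.mk y ⁻¹' s)) hy
  simp only [condMeasure, Measure.smul_apply, smul_eq_mul] at h2
  rw [withDensity_apply _ (hs' y), ← lintegral_indicator (hs' y)] at h2
  exact h2

lemma condKernel_ac_of_ac {α β : Measure (Y × EuclideanSpace ℝ (Fin d))}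
    [IsFiniteMeasure α] [IsFiniteMeasure β] (h : α ≪ β) :
    ∀ᵐ y ∂α.fst, α.condKernel y ≪ β.condKernel y := by
  refine Measure.AbsolutelyContinuous.kernel_of_compProd (ν := β.fst) ?_
  rwa [α.disintegrate, β.disintegrate]

lemma neg_le_csiszar (hΨ : IsEntropy Ψ) (h : HasDiffConj Ψ)
    {α β : Measure (EuclideanSpace ℝ (Fin d))} [IsProbabilityMeasure β] :
    ((-|conjReal Ψ 0| : ℝ) : EReal) ≤ csiszar Ψ α β := by
  unfold csiszar
  rw [hΨ.recession_eq_top h]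
  refine le_add_of_le_of_nonneg (neg_le_eintegral (abs_nonneg _) fun x => hΨ.neg_abs_le h _) ?_
  exact mul_nonneg le_top (EReal.coe_ennreal_nonneg _)

lemma neg_le_condDiv (hΨ : IsEntropy Ψ) (h : HasDiffConj Ψ)
    (α β : Measure (Y × EuclideanSpace ℝ (Fin d))) [IsFiniteMeasure α] [IsProbabilityMeasure β] :
    ((-|conjReal Ψ 0| : ℝ) : EReal) ≤ condDiv Ψ β.fst α β :=
  neg_le_eintegral (abs_nonneg _) fun _ => neg_le_csiszar hΨ h

/-- Since the recession constant is infinite, a finite divergence forces the conditional measures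
to be absolutely continuous. -/
lemma condKernel_ac_of_condDiv_ne_top (hΨ : IsEntropy Ψ) (h : HasDiffConj Ψ)
    {α β : Measure (Y × EuclideanSpace ℝ (Fin d))} [IsFiniteMeasure α] [IsProbabilityMeasure β]
    (hac : α.fst ≪ β.fst) (hfin : condDiv Ψ β.fst α β ≠ ⊤) :
    ∀ᵐ y ∂α.fst, α.condKernel y ≪ β.condKernel y := by
  set r := α.fst.rnDeriv β.fst
  have hr : Measurable r := Measure.measurable_rnDeriv _ _
  have hαr : α.fst = β.fst.withDensity r := (Measure.withDensity_rnDeriv_eq _ _ hac).symm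
  rw [hαr, ae_withDensity_iff hr]
  -- where `r = 0` the conditional measure vanishes, whatever `α.condKernel y` is
  set N : Set Y := {y | r y ≠ 0 ∧ ¬ α.condKernel y ≪ β.condKernel y}
  have hN : MeasurableSet N :=
    (hr (measurableSet_singleton 0).compl).inter
      (Kernel.measurableSet_absolutelyContinuous α.condKernel β.condKernel).compl
  have htop : ∀ y ∈ N, csiszar Ψ (condMeasure β.fst α y) (β.condKernel y) = ⊤ := by
    rintro y ⟨hy0, hy⟩
    have hsing : (condMeasure β.fst α y).singularPart (β.condKernel y) univ ≠ 0 := by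
      intro h0
      unfold condMeasure at h0
      rw [Measure.measure_univ_eq_zero, Measure.singularPart_eq_zero] at h0
      refine hy (Measure.AbsolutelyContinuous.trans ?_ h0)
      exact Measure.absolutelyContinuous_smul hy0
    unfold csiszar
    rw [hΨ.recession_eq_top h, EReal.top_mul_of_pos]
    · refine EReal.add_top_of_ne_bot fun hb => ?_
      have := neg_le_eintegral (μ := β.condKernel y) (abs_nonneg _) fun x => hΨ.neg_abs_le h
        ((condMeasure β.fst α y).rnDeriv (β.condKernel y) x).toNNReal
      rw [hb] at this
      exact absurd this (not_le.2 (EReal.bot_lt_coe _))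
    · exact lt_of_le_of_ne (EReal.coe_ennreal_nonneg _) fun h0 => hsing (by simpa using h0.symm)
  have hNnull : β.fst N = 0 := by
    by_contra hne
    refine hfin ?_
    have hneg := (lintegral_toENNReal_neg_le (μ := β.fst)
      fun y => neg_le_csiszar hΨ h (α := condMeasure β.fst α y) (β := β.condKernel y)).trans_lt
        ENNReal.ofReal_lt_top
    have hpos : ∫⁻ y, (csiszar Ψ (condMeasure β.fst α y) (β.condKernel y)).toENNReal ∂β.fst
        = ∞ := by
      refine top_le_iff.1 ?_
      calc ∞ = ∫⁻ y in N, ∞ ∂β.fst := by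
            rw [setLIntegral_const, ENNReal.top_mul hne]
        _ = ∫⁻ y in N, (csiszar Ψ (condMeasure β.fst α y) (β.condKernel y)).toENNReal ∂β.fst :=
            setLIntegral_congr_fun hN fun y hy => by simp [htop y hy]
        _ ≤ _ := setLIntegral_le_lintegral _ _
    unfold condDiv eintegral
    lift ∫⁻ y, (-csiszar Ψ (condMeasure β.fst α y) (β.condKernel y)).toENNReal ∂β.fst
      to ℝ≥0 using hneg.ne with B
    rw [hpos]
    rfl
  filter_upwards [measure_eq_zero_iff_ae_notMem.1 hNnull] with y hy hy0
  by_contra hc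
  exact hy ⟨hy0, hc⟩

/-- The integrated conditional divergence is the divergence of the joint measures. -/
lemma condDiv_eq_eintegral (hΨ : IsEntropy Ψ) (h : HasDiffConj Ψ)
    {α β : Measure (Y × EuclideanSpace ℝ (Fin d))} [IsFiniteMeasure α] [IsProbabilityMeasure β]
    {ρ : Y × EuclideanSpace ℝ (Fin d) → ℝ≥0∞} (hρ : Measurable ρ)
    (hcond : ∀ᵐ y ∂β.fst, condMeasure β.fst α y
      = (β.condKernel y).withDensity fun x => ρ (y, x)) :
    condDiv Ψ β.fst α β = eintegral β fun p => Ψ (ρ p).toNNReal := by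
  set M : ℝ := |conjReal Ψ 0|
  have hM : 0 ≤ M := abs_nonneg _
  set f : Y × EuclideanSpace ℝ (Fin d) → EReal := fun p => Ψ (ρ p).toNNReal
  have hf : Measurable f := hΨ.lsc.measurable.comp hρ.ennreal_toNNReal
  have hfM : ∀ p, ((-M : ℝ) : EReal) ≤ f p := fun p => hΨ.neg_abs_le h _
  set F : Y → EReal := fun y => eintegral (β.condKernel y) fun x => f (y, x)
  have hF : ∀ y, F y + M = ((∫⁻ x, (f (y, x) + M).toENNReal ∂β.condKernel y : ℝ≥0∞) : EReal) :=
    fun y => eintegral_add_const hM (hf.comp measurable_prodMk_left).aemeasurable fun x => hfM _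
  have hFM : ∀ y, ((-M : ℝ) : EReal) ≤ F y := fun y => neg_le_eintegral hM fun x => hfM _
  have hg : Measurable fun p => (f p + M).toENNReal := (hf.add_const _).ereal_toENNReal
  have hcs : ∀ᵐ y ∂β.fst, csiszar Ψ (condMeasure β.fst α y) (β.condKernel y) = F y := by
    filter_upwards [hcond] with y hy
    have hsec : Measurable fun x => ρ (y, x) := hρ.comp measurable_prodMk_left
    unfold csiszar
    rw [hy, Measure.singularPart_eq_zero_of_ac (withDensity_absolutelyContinuous _ _)]
    simp only [Measure.coe_zero, Pi.zero_apply, EReal.coe_ennreal_zero, mul_zero, add_zero]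
    refine eintegral_congr_ae ?_
    filter_upwards [Measure.rnDeriv_withDensity (β.condKernel y) hsec] with x hx
    rw [hx]
  unfold condDiv
  rw [eintegral_congr_ae hcs]
  have hFmeas : Measurable F := by
    have : F = fun y => ((∫⁻ x, (f (y, x) + M).toENNReal ∂β.condKernel y : ℝ≥0∞) : EReal)
        + ((-M : ℝ) : EReal) := by
      ext1 y
      rw [← hF y, add_assoc, ← EReal.coe_add, add_neg_cancel, EReal.coe_zero, add_zero]
    rw [this]
    exact (measurable_coe_ennreal_ereal.comp hg.lintegral_kernel_prod_right').add_const _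
  have key : eintegral β.fst F + M = eintegral β f + M := by
    rw [eintegral_add_const hM hFmeas.aemeasurable hFM,
      eintegral_add_const hM hf.aemeasurable hfM, ← Measure.lintegral_condKernel hg]
    simp only [hF, EReal.toENNReal_coe]
  have := congrArg (fun z : EReal => z + ((-M : ℝ) : EReal)) key
  simpa only [add_assoc, ← EReal.coe_add, add_neg_cancel, EReal.coe_zero, add_zero] using this

end CondDivergence

/-! ### The integrated Fenchel-Young inequality -/

section Duality

variable {Y : Type*} [MeasurableSpace Y] {d : ℕ} {Ψ : ℝ≥0 → EReal}

/-- Monotone functions of bounded measurable functions are integrable. -/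
lemma Monotone.integrable_comp {α : Type*} [MeasurableSpace α] {μ : Measure α} [IsFiniteMeasure μ]
    {F : ℝ → ℝ} (hF : Monotone F) {s : α → ℝ} (hs : AEStronglyMeasurable s μ) {C : ℝ}
    (hC : ∀ᵐ x ∂μ, |s x| ≤ C) : Integrable (fun x => F (s x)) μ := by
  refine Integrable.of_bound
    (hF.measurable.comp_aemeasurable hs.aemeasurable).aestronglyMeasurable (max |F (-C)| |F C|) ?_
  filter_upwards [hC] with x hx
  exact abs_le_max_abs_abs (hF (abs_le.1 hx).1) (hF (abs_le.1 hx).2)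

/-- The measure `Ψ*'(s) dβ`, the unique measure at which the divergence from `β` attains equality
in the Fenchel-Young inequality for the potential `s`. -/
noncomputable def conjDensity (Ψ : ℝ≥0 → EReal) {X : Type*} [MeasurableSpace X]
    (β : Measure X) (s : X → ℝ) : Measure X :=
  β.withDensity fun p => ENNReal.ofReal (deriv (conjReal Ψ) (s p))

section

variable {X : Type*} [MeasurableSpace X] {β : Measure X} {s : X → ℝ}

lemma aemeasurable_deriv_conjReal_comp (hs : AEStronglyMeasurable s β) :
    AEMeasurable (fun p => ENNReal.ofReal (deriv (conjReal Ψ) (s p))) β :=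
  ((measurable_deriv _).comp_aemeasurable hs.aemeasurable).ennreal_ofReal

lemma isFiniteMeasure_conjDensity [IsFiniteMeasure β] (hΨ : IsEntropy Ψ) (h : HasDiffConj Ψ)
    (hs : AEStronglyMeasurable s β) {C : ℝ} (hC : ∀ᵐ p ∂β, |s p| ≤ C) :
    IsFiniteMeasure (conjDensity Ψ β s) :=
  isFiniteMeasure_withDensity
    ((hΨ.monotone_deriv_conjReal h).integrable_comp hs hC).lintegral_lt_top.ne

lemma conjDensity_ac : conjDensity Ψ β s ≪ β := withDensity_absolutelyContinuous _ _

lemma integral_conjDensity (hΨ : IsEntropy Ψ) (h : HasDiffConj Ψ)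
    (hs : AEStronglyMeasurable s β) (g : X → ℝ) :
    ∫ p, g p ∂(conjDensity Ψ β s) = ∫ p, deriv (conjReal Ψ) (s p) * g p ∂β := by
  unfold conjDensity
  rw [integral_withDensity_eq_integral_toReal_smul₀ (aemeasurable_deriv_conjReal_comp hs)
    (by simp)]
  simp only [ENNReal.toReal_ofReal (hΨ.deriv_conjReal_nonneg h _), smul_eq_mul]

end

/-- Duality for one divergence: a plan marginal `α` of finite divergence satisfies the integrated
Fenchel-Young inequality, and equality determines `α`. -/
lemma fenchel_young_condDiv (hΨ : IsEntropy Ψ) (h : HasDiffConj Ψ)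
    {α β : Measure (Y × EuclideanSpace ℝ (Fin d))} [IsFiniteMeasure α] [IsProbabilityMeasure β]
    (hac : α.fst ≪ β.fst) (hfin : condDiv Ψ β.fst α β ≠ ⊤)
    {s : Y × EuclideanSpace ℝ (Fin d) → ℝ} (hs : AEStronglyMeasurable s β) {C : ℝ}
    (hC : ∀ᵐ p ∂β, |s p| ≤ C) :
    α ≪ β ∧ ∃ r : ℝ, condDiv Ψ β.fst α β = r ∧
      (∫ p, s p ∂α) - ∫ p, conjReal Ψ (s p) ∂β ≤ r ∧
      (r = (∫ p, s p ∂α) - ∫ p, conjReal Ψ (s p) ∂β → α = conjDensity Ψ β s) := by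
  obtain ⟨ρ, hρ, hαρ, hcond⟩ := exists_density_of_condKernel_ac α β hac
    (condKernel_ac_of_condDiv_ne_top hΨ h hac hfin)
  have hαβ : α ≪ β := hαρ ▸ withDensity_absolutelyContinuous _ _
  rw [condDiv_eq_eintegral hΨ h hρ hcond] at hfin ⊢
  have hf : Measurable fun p => Ψ (ρ p).toNNReal := hΨ.lsc.measurable.comp hρ.ennreal_toNNReal
  obtain ⟨hg, hgae⟩ := integrable_toReal_of_eintegral_ne_top hf (fun p => hΨ.neg_abs_le h _) hfin
  have hρfin : ∫⁻ p, ρ p ∂β ≠ ∞ := by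
    have := measure_lt_top α univ
    rw [hαρ, withDensity_apply _ MeasurableSet.univ, Measure.restrict_univ] at this
    exact this.ne
  have hρlt : ∀ᵐ p ∂β, ρ p < ∞ := ae_lt_top hρ hρfin
  have hρint : Integrable (fun p => (ρ p).toReal) β :=
    integrable_toReal_of_lintegral_ne_top hρ.aemeasurable hρfin
  have hsα : ∫ p, s p ∂α = ∫ p, (ρ p).toReal * s p ∂β := by
    conv_lhs => rw [hαρ]
    rw [integral_withDensity_eq_integral_toReal_smul₀ hρ.aemeasurable hρlt]
    rfl
  have hsρ : Integrable (fun p => (ρ p).toReal * s p) β :=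
    hρint.mul_bdd hs (c := C) (by simpa using hC)
  have hconj : Integrable (fun p => conjReal Ψ (s p)) β :=
    (hΨ.monotone_conjReal h).integrable_comp hs hC
  have hdiff := hsρ.sub hconj
  have hle : ∀ᵐ p ∂β, (ρ p).toReal * s p - conjReal Ψ (s p) ≤ (Ψ (ρ p).toNNReal).toReal := by
    filter_upwards [hgae] with p hp
    have := hΨ.fenchel_young h (s p) (ρ p).toNNReal
    rw [hp, EReal.coe_le_coe_iff, mul_comm] at this
    exact this
  have hsub : ∫ p, (ρ p).toReal * s p - conjReal Ψ (s p) ∂β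
      = (∫ p, s p ∂α) - ∫ p, conjReal Ψ (s p) ∂β := by
    rw [hsα, integral_sub hsρ hconj]
  refine ⟨hαβ, _, eintegral_coe hg hgae, ?_, fun heq => ?_⟩
  · rw [← hsub]
    exact integral_mono_ae hdiff hg hle
  · rw [← hsub] at heq
    have hzero := (integral_eq_iff_of_ae_le hdiff hg hle).1 heq.symm
    rw [hαρ]
    refine withDensity_congr_ae ?_
    filter_upwards [hzero, hgae, hρlt] with p hp hp' hlt
    have hx : Ψ (ρ p).toNNReal = ((s p * (ρ p).toNNReal - conjReal Ψ (s p) : ℝ) : EReal) := by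
      rw [hp', ← hp, mul_comm]
      rfl
    rw [← hΨ.eq_deriv_of_fenchel_eq h hx, ENNReal.ofReal_coe_nnreal, ENNReal.coe_toNNReal hlt.ne]

/-- The measure `Ψ*'(s) dβ` attains equality in the integrated Fenchel-Young inequality. -/
lemma condDiv_conjDensity (hΨ : IsEntropy Ψ) (h : HasDiffConj Ψ)
    {α β : Measure (Y × EuclideanSpace ℝ (Fin d))} [IsFiniteMeasure α] [IsProbabilityMeasure β]
    {s : Y × EuclideanSpace ℝ (Fin d) → ℝ} (hs : AEStronglyMeasurable s β) {C : ℝ}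
    (hC : ∀ᵐ p ∂β, |s p| ≤ C) (hα : α = conjDensity Ψ β s) :
    condDiv Ψ β.fst α β = (((∫ p, s p ∂α) - ∫ p, conjReal Ψ (s p) ∂β : ℝ) : EReal) := by
  have hαβ : α ≪ β := hα ▸ conjDensity_ac
  obtain ⟨ρ, hρ, hαρ, hcond⟩ := exists_density_of_condKernel_ac α β
    (hαβ.map measurable_fst) (condKernel_ac_of_ac hαβ)
  have hderiv := (hΨ.monotone_deriv_conjReal h).integrable_comp hs hC
  have hρeq : ρ =ᵐ[β] fun p => ENNReal.ofReal (deriv (conjReal Ψ) (s p)) := by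
    refine (withDensity_eq_iff hρ.aemeasurable (aemeasurable_deriv_conjReal_comp hs) ?_).1
      (hαρ.symm.trans hα)
    have := measure_lt_top α univ
    rw [hαρ, withDensity_apply _ MeasurableSet.univ, Measure.restrict_univ] at this
    exact this.ne
  rw [condDiv_eq_eintegral hΨ h hρ hcond, hα, integral_conjDensity hΨ h hs]
  have h1 : Integrable (fun p => deriv (conjReal Ψ) (s p) * s p) β :=
    hderiv.mul_bdd hs (c := C) (by simpa using hC)
  have h2 : Integrable (fun p => conjReal Ψ (s p)) β :=
    (hΨ.monotone_conjReal h).integrable_comp hs hC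
  rw [← integral_sub h1 h2]
  refine eintegral_coe (h1.sub h2) ?_
  filter_upwards [hρeq] with p hp
  rw [hp, mul_comm, ← hΨ.apply_deriv_conjReal h]
  rfl

lemma condDiv_self (hΨ : IsEntropy Ψ) (h : HasDiffConj Ψ)
    {β : Measure (Y × EuclideanSpace ℝ (Fin d))} [IsProbabilityMeasure β] :
    condDiv Ψ β.fst β β = 0 := by
  have hcond : ∀ᵐ y ∂β.fst, condMeasure β.fst β y
      = (β.condKernel y).withDensity fun x => (fun _ => (1 : ℝ≥0∞)) (y, x) := by
    filter_upwards [Measure.rnDeriv_self β.fst] with y hy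
    simp [condMeasure, hy]
  rw [condDiv_eq_eintegral hΨ h measurable_const hcond,
    eintegral_coe (integrable_zero _ ℝ _) (by simp [hΨ.one])]
  simp

end Duality

/-! ### Kantorovich duality on a compact space -/

section Kantorovich

open scoped BoundedContinuousFunction

/-- On a compact space, positive linear functionals on continuous functions are integrals. -/
lemma exists_measure_eq_integral {K : Type*} [TopologicalSpace K] [T2Space K] [CompactSpace K]
    [MeasurableSpace K] [BorelSpace K] (L : C(K, ℝ) →ₗ[ℝ] ℝ) (hL : ∀ f, 0 ≤ f → 0 ≤ L f) :
    ∃ m : Measure K, IsFiniteMeasure m ∧ ∀ f : C(K, ℝ), ∫ k, f k ∂m = L f := by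
  let Λ : CompactlySupportedContinuousMap K ℝ →ₚ[ℝ] ℝ := PositiveLinearMap.mk₀
    { toFun := fun f => L f.toContinuousMap
      map_add' := fun f g => L.map_add f.toContinuousMap g.toContinuousMap
      map_smul' := fun r f => L.map_smul r f.toContinuousMap }
    fun f hf => hL _ hf
  exact ⟨RealRMK.rieszMeasure Λ, inferInstance, fun f =>
    RealRMK.integral_rieszMeasure Λ (CompactlySupportedContinuousMap.continuousMapEquiv f)⟩

/-- Kantorovich duality on a compact space `K` with two continuous maps `a` and `b`: if every dual
competitor has value at most `B`, then there is a measure on `K` with the prescribed images under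
`a` and `b` and with cost at most `B`. Taking for `K` a fibre product gives the conditional
transport problem. The measure is a Hahn-Banach extension of the zero functional that stays below
the smallest value of a dual competitor, where competitors may also use multiples of the cost. -/
theorem exists_coupling_of_dual_le {K X Z : Type*} [TopologicalSpace K] [T2Space K]
    [CompactSpace K] [MeasurableSpace K] [BorelSpace K]
    [TopologicalSpace X] [MeasurableSpace X] [BorelSpace X] [HasOuterApproxClosed X]
    [TopologicalSpace Z] [MeasurableSpace Z] [BorelSpace Z] [HasOuterApproxClosed Z]
    {a : K → X} {b : K → Z} (ha : Continuous a) (hb : Continuous b)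
    (α : Measure X) (β : Measure Z) [IsFiniteMeasure α] [IsFiniteMeasure β]
    (c : C(K, ℝ)) (B : ℝ)
    (hB : ∀ (g : X →ᵇ ℝ) (h : Z →ᵇ ℝ), (∀ k, g (a k) + h (b k) ≤ c k) →
      ∫ x, g x ∂α + ∫ z, h z ∂β ≤ B) :
    ∃ m : Measure K, IsFiniteMeasure m ∧ m.map a = α ∧ m.map b = β ∧ ∫ k, c k ∂m ≤ B := by
  let S : C(K, ℝ) → Set ℝ := fun f => {r | ∃ (g : X →ᵇ ℝ) (h : Z →ᵇ ℝ) (t : ℝ), 0 ≤ t ∧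
    (∀ k, f k ≤ g (a k) + h (b k) + t * c k) ∧ r = ∫ x, g x ∂α + ∫ z, h z ∂β + t * B}
  have hne : ∀ f, (S f).Nonempty := fun f =>
    ⟨_, BoundedContinuousFunction.const X ‖f‖, 0, 0, le_rfl, fun k => by
      simpa using (le_abs_self _).trans (f.norm_coe_le_norm k), rfl⟩
  have hbdd : ∀ f, BddBelow (S f) := by
    refine fun f => ⟨-(‖f‖ + ‖c‖) * α.real univ - B, ?_⟩
    rintro r ⟨g, h, t, ht, hle, rfl⟩
    -- `-g - h`, lowered by a constant, is at most `(t + 1) c`; the extra `1` covers `t = 0`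
    have ht1 : 0 < t + 1 := by linarith
    have key := hB ((t + 1)⁻¹ • (-g - BoundedContinuousFunction.const X (‖f‖ + ‖c‖)))
      ((t + 1)⁻¹ • (-h)) fun k => by
        have h1 := abs_le.1 (f.norm_coe_le_norm k)
        have h2 := abs_le.1 (c.norm_coe_le_norm k)
        have h3 := hle k
        simp only [BoundedContinuousFunction.coe_smul, BoundedContinuousFunction.coe_sub,
          BoundedContinuousFunction.coe_neg, Pi.sub_apply, Pi.neg_apply, smul_eq_mul,
          BoundedContinuousFunction.const_apply]
        rw [← mul_add, inv_mul_le_iff₀ ht1]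
        linarith
    simp only [BoundedContinuousFunction.coe_smul, BoundedContinuousFunction.coe_sub,
      BoundedContinuousFunction.coe_neg, Pi.sub_apply, Pi.neg_apply, smul_eq_mul,
      BoundedContinuousFunction.const_apply] at key
    have hg : Integrable (fun x => -g x) α := (g.integrable α).neg
    rw [integral_const_mul, integral_const_mul, integral_sub hg (integrable_const _),
      integral_neg, integral_neg, integral_const, ← mul_add,
      inv_mul_le_iff₀ ht1, smul_eq_mul] at key
    linarith
  let N : C(K, ℝ) → ℝ := fun f => sInf (S f)
  have hN : ∀ f r, r ∈ S f → N f ≤ r := fun f r hr => csInf_le (hbdd f) hr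
  have hsmul : ∀ t : ℝ, 0 < t → ∀ f r, r ∈ S f → t * r ∈ S (t • f) := by
    rintro t ht f r ⟨g, h, u, hu, hle, rfl⟩
    refine ⟨t • g, t • h, t * u, by positivity, fun k => ?_, ?_⟩
    · have := mul_le_mul_of_nonneg_left (hle k) ht.le
      simp only [ContinuousMap.coe_smul, Pi.smul_apply, smul_eq_mul,
        BoundedContinuousFunction.coe_smul]
      linarith
    · simp only [BoundedContinuousFunction.coe_smul, smul_eq_mul, integral_const_mul]
      ring
  have hle_smul : ∀ t : ℝ, 0 < t → ∀ f, N (t • f) ≤ t * N f := by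
    intro t ht f
    rw [← div_le_iff₀' ht]
    refine le_csInf (hne f) fun r hr => ?_
    rw [div_le_iff₀' ht]
    exact hN _ _ (hsmul t ht f r hr)
  have hN_hom : ∀ t : ℝ, 0 < t → ∀ f, N (t • f) = t * N f := by
    intro t ht f
    refine le_antisymm (hle_smul t ht f) ?_
    have := hle_smul t⁻¹ (inv_pos.2 ht) (t • f)
    rwa [inv_smul_smul₀ ht.ne', le_inv_mul_iff₀ ht] at this
  have hN_add : ∀ f f', N (f + f') ≤ N f + N f' := by
    intro f f'
    have h1 : ∀ r ∈ S f, ∀ r' ∈ S f', N (f + f') ≤ r + r' := by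
      rintro r ⟨g, h, t, ht, hle, rfl⟩ r' ⟨g', h', t', ht', hle', rfl⟩
      refine hN _ _ ⟨g + g', h + h', t + t', by positivity, fun k => ?_, ?_⟩
      · have h1 := hle k
        have h2 := hle' k
        simp only [ContinuousMap.coe_add, Pi.add_apply, BoundedContinuousFunction.coe_add]
        linarith
      · simp only [BoundedContinuousFunction.coe_add, Pi.add_apply]
        rw [integral_add (g.integrable α) (g'.integrable α),
          integral_add (h.integrable β) (h'.integrable β)]
        ring
    have h2 : ∀ r ∈ S f, N (f + f') - r ≤ N f' := fun r hr =>
      le_csInf (hne f') fun r' hr' => by linarith [h1 r hr r' hr']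
    have h3 : N (f + f') - N f' ≤ N f := le_csInf (hne f) fun r hr => by linarith [h2 r hr]
    linarith
  obtain ⟨L, -, hLN⟩ := exists_extension_of_le_sublinear (⊥ : C(K, ℝ) →ₗ.[ℝ] ℝ) N hN_hom hN_add
    (by
      rintro ⟨f, hf⟩
      have hf0 : f = 0 := (Submodule.mem_bot ℝ).1 hf
      subst hf0
      have h0 : N 0 = 0 := by
        have := hN_hom 2 two_pos 0
        rw [smul_zero] at this
        linarith
      change (0 : ℝ) ≤ N 0
      rw [h0])
  have hLS : ∀ (f : C(K, ℝ)) (g : X →ᵇ ℝ) (h : Z →ᵇ ℝ) (t : ℝ), 0 ≤ t →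
      (∀ k, f k ≤ g (a k) + h (b k) + t * c k) → L f ≤ ∫ x, g x ∂α + ∫ z, h z ∂β + t * B :=
    fun f g h t ht hle => (hLN f).trans (hN _ _ ⟨g, h, t, ht, hle, rfl⟩)
  obtain ⟨m, hm, hmL⟩ := exists_measure_eq_integral L fun f hf => by
    have := hLS (-f) 0 0 0 le_rfl fun k => by simpa using hf k
    simpa using this
  refine ⟨m, hm, ?_, ?_, ?_⟩
  · refine ext_of_forall_integral_eq_of_IsFiniteMeasure fun g => ?_
    rw [integral_map ha.measurable.aemeasurable g.continuous.aestronglyMeasurable]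
    have hle : ∀ g : X →ᵇ ℝ, L (g.toContinuousMap.comp ⟨a, ha⟩) ≤ ∫ x, g x ∂α := fun g => by
      have := hLS (g.toContinuousMap.comp ⟨a, ha⟩) g 0 0 le_rfl fun k => by simp
      simpa using this
    have hge := hle (-g)
    have hneg : (-g).toContinuousMap.comp ⟨a, ha⟩ = -(g.toContinuousMap.comp ⟨a, ha⟩) := rfl
    rw [hneg, map_neg] at hge
    simp only [BoundedContinuousFunction.coe_neg, Pi.neg_apply, integral_neg] at hge
    have := hmL (g.toContinuousMap.comp ⟨a, ha⟩)
    have h2 := hle g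
    refine Eq.trans this ?_
    linarith
  · refine ext_of_forall_integral_eq_of_IsFiniteMeasure fun g => ?_
    rw [integral_map hb.measurable.aemeasurable g.continuous.aestronglyMeasurable]
    have hle : ∀ g : Z →ᵇ ℝ, L (g.toContinuousMap.comp ⟨b, hb⟩) ≤ ∫ x, g x ∂β := fun g => by
      have := hLS (g.toContinuousMap.comp ⟨b, hb⟩) 0 g 0 le_rfl fun k => by simp
      simpa using this
    have hge := hle (-g)
    have hneg : (-g).toContinuousMap.comp ⟨b, hb⟩ = -(g.toContinuousMap.comp ⟨b, hb⟩) := rfl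
    rw [hneg, map_neg] at hge
    simp only [BoundedContinuousFunction.coe_neg, Pi.neg_apply, integral_neg] at hge
    have := hmL (g.toContinuousMap.comp ⟨b, hb⟩)
    have h2 := hle g
    refine Eq.trans this ?_
    linarith
  · rw [hmL]
    have := hLS c 0 0 1 zero_le_one fun k => by simp
    simpa using this

end Kantorovich

/-! ### The `c`-transform and its minimizers -/

section CTransform

variable {Y : Type*} {d : ℕ} {τ : ℝ} {U : Set (EuclideanSpace ℝ (Fin d))}
  {φ : Y × EuclideanSpace ℝ (Fin d) → ℝ}

lemma Continuous.qcost {X : Type*} [TopologicalSpace X] {f g : X → EuclideanSpace ℝ (Fin d)}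
    (hf : Continuous f) (hg : Continuous g) : Continuous fun x => qcost τ (f x) (g x) := by
  unfold _root_.qcost
  fun_prop

lemma qcost_nonneg (hτ : 0 ≤ τ) (v u : EuclideanSpace ℝ (Fin d)) : 0 ≤ qcost τ v u := by
  unfold qcost
  positivity

lemma IsArgmin.le {p : Y × EuclideanSpace ℝ (Fin d)} {u w : EuclideanSpace ℝ (Fin d)}
    (h : IsArgmin τ U φ p u) (hw : w ∈ U) :
    qcost τ p.2 u - φ (p.1, u) ≤ qcost τ p.2 w - φ (p.1, w) :=
  isMinOn_iff.1 h.2 w hw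

lemma cTransform_eq_of_isArgmin {p : Y × EuclideanSpace ℝ (Fin d)} {u : EuclideanSpace ℝ (Fin d)}
    (h : IsArgmin τ U φ p u) : cTransform τ U φ p = qcost τ p.2 u - φ (p.1, u) := by
  have : Nonempty U := ⟨⟨u, h.1⟩⟩
  unfold cTransform
  refine le_antisymm ?_ (le_ciInf fun w => h.le w.2)
  have hbdd : BddBelow (range fun w : U =>
      qcost τ p.2 (w : EuclideanSpace ℝ (Fin d)) - φ (p.1, (w : EuclideanSpace ℝ (Fin d)))) := by
    refine ⟨qcost τ p.2 u - φ (p.1, u), ?_⟩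
    rintro _ ⟨w, rfl⟩
    exact h.le w.2
  exact ciInf_le hbdd ⟨u, h.1⟩

variable [TopologicalSpace Y]

lemma isPotential_of_continuous (hφ : Continuous φ) : IsPotential U φ := hφ.continuousOn

lemma IsPotential.continuous_sub {X : Type*} [TopologicalSpace X] (hφ : IsPotential U φ)
    {p : X → Y × EuclideanSpace ℝ (Fin d)} {u : X → EuclideanSpace ℝ (Fin d)}
    (hp : Continuous p) (hu : Continuous u) (huU : ∀ x, u x ∈ U) :
    Continuous fun x => qcost τ (p x).2 (u x) - φ ((p x).1, u x) :=
  (hp.snd.qcost hu).sub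
    (ContinuousOn.comp_continuous hφ (hp.fst.prodMk hu) fun x => ⟨mem_univ _, huU x⟩)

lemma exists_isArgmin (hU : IsCompact U) (hne : U.Nonempty) (hφ : IsPotential U φ)
    (p : Y × EuclideanSpace ℝ (Fin d)) : ∃ u, IsArgmin τ U φ p u := by
  have hc : ContinuousOn (fun u => qcost τ p.2 u - φ (p.1, u)) U := by
    rw [continuousOn_iff_continuous_domRestrict]
    exact hφ.continuous_sub (X := U) (p := fun _ => p)
      (u := fun u => (u : EuclideanSpace ℝ (Fin d)))
      continuous_const continuous_subtype_val fun u => u.2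
  obtain ⟨u, hu, hmin⟩ := hU.exists_isMinOn hne hc
  exact ⟨u, hu, hmin⟩

lemma cTransform_le (hU : IsCompact U) (hφ : IsPotential U φ)
    (p : Y × EuclideanSpace ℝ (Fin d)) {u : EuclideanSpace ℝ (Fin d)} (hu : u ∈ U) :
    cTransform τ U φ p ≤ qcost τ p.2 u - φ (p.1, u) := by
  obtain ⟨w, hw⟩ := exists_isArgmin (τ := τ) hU ⟨u, hu⟩ hφ p
  rw [cTransform_eq_of_isArgmin hw]
  exact hw.le hu

lemma isArgmin_iff (hU : IsCompact U) (hφ : IsPotential U φ)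
    (p : Y × EuclideanSpace ℝ (Fin d)) {u : EuclideanSpace ℝ (Fin d)} (hu : u ∈ U) :
    IsArgmin τ U φ p u ↔ cTransform τ U φ p = qcost τ p.2 u - φ (p.1, u) := by
  refine ⟨cTransform_eq_of_isArgmin, fun h => ⟨hu, fun w hw => ?_⟩⟩
  have := cTransform_le (τ := τ) hU hφ p hw
  rw [h] at this
  exact this

lemma continuous_cTransform (hU : IsCompact U) (hφ : IsPotential U φ) :
    Continuous (cTransform τ U φ) := by
  have := isCompact_iff_compactSpace.1 hU
  have h := IsCompact.continuous_sInf
    (f := fun (p : Y × EuclideanSpace ℝ (Fin d)) (u : U) =>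
      qcost τ p.2 (u : EuclideanSpace ℝ (Fin d)) - φ (p.1, u)) isCompact_univ
    (hφ.continuous_sub (X := (Y × EuclideanSpace ℝ (Fin d)) × U) (p := fun q => q.1)
      (u := fun q => (q.2 : EuclideanSpace ℝ (Fin d))) continuous_fst
      (continuous_subtype_val.comp continuous_snd) fun q => q.2.2)
  simp only [image_univ] at h
  exact h

/-- Minimizers of a continuous function over a compact set can be selected measurably. The compact
set is parameterized by a compact set of real numbers (the Cantor set), and the selection is the
smallest parameter of a minimizer: this parameter is a lower semicontinuous function. -/
lemma exists_measurable_isArgmin [MeasurableSpace Y] [SecondCountableTopology Y]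
    [BorelSpace Y] (hU : IsCompact U) (hne : U.Nonempty) (hφ : IsPotential U φ) :
    ∃ S : Y × EuclideanSpace ℝ (Fin d) → EuclideanSpace ℝ (Fin d),
      Measurable S ∧ ∀ p, IsArgmin τ U φ p (S p) := by
  have := isCompact_iff_compactSpace.1 hU
  have : Nonempty U := hne.to_subtype
  obtain ⟨f, hf, hfs⟩ := exists_nat_bool_continuous_surjective_of_compact U
  set q : cantorSet → U := f ∘ cantorSetHomeomorphNatToBool
  have hq : Continuous q := hf.comp (Homeomorph.continuous _)
  have hqs : Function.Surjective q := hfs.comp (Homeomorph.surjective _)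
  -- the parameters of minimizers, as a closed subset of `X × C`
  set A : Set ((Y × EuclideanSpace ℝ (Fin d)) × cantorSet) :=
    {z | qcost τ z.1.2 (q z.2 : EuclideanSpace ℝ (Fin d)) - φ (z.1.1, q z.2)
      ≤ cTransform τ U φ z.1}
  have hA : IsClosed A := isClosed_le
    (hφ.continuous_sub (p := fun z : (Y × EuclideanSpace ℝ (Fin d)) × cantorSet => z.1)
      (u := fun z => (q z.2 : EuclideanSpace ℝ (Fin d))) continuous_fst
      (continuous_subtype_val.comp (hq.comp continuous_snd)) fun z => (q z.2).2)
    ((continuous_cTransform (τ := τ) hU hφ).comp continuous_fst)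
  have : CompactSpace cantorSet := isCompact_iff_compactSpace.1 isCompact_cantorSet
  have hmin : ∀ p, ∃ t : cantorSet, (p, t) ∈ A ∧ ∀ s, (p, s) ∈ A → (t : ℝ) ≤ s := by
    intro p
    have hAp : IsClosed {t : cantorSet | (p, t) ∈ A} :=
      hA.preimage (by fun_prop : Continuous fun t : cantorSet => (p, t))
    obtain ⟨u, hu⟩ := exists_isArgmin (τ := τ) hU hne hφ p
    obtain ⟨t, ht⟩ := hqs ⟨u, hu.1⟩
    have htA : (p, t) ∈ A := by
      change qcost τ p.2 (q t : EuclideanSpace ℝ (Fin d)) - φ (p.1, q t) ≤ _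
      rw [ht, cTransform_eq_of_isArgmin hu]
    obtain ⟨s, hs, hs'⟩ := hAp.isCompact.exists_isMinOn ⟨t, htA⟩
      (continuous_subtype_val.continuousOn)
    exact ⟨s, hs, fun r hr => hs' hr⟩
  choose m hmA hm using hmin
  have hmm : Measurable m := by
    refine Measurable.subtype_mk (f := fun p => (m p : ℝ)) (h := fun p => (m p).2) ?_
    refine measurable_of_Iic fun r => ?_
    have : (fun p => (m p : ℝ)) ⁻¹' Iic r = Prod.fst '' (A ∩ {z | (z.2 : ℝ) ≤ r}) := by
      ext p
      constructor
      · exact fun hp => ⟨(p, m p), ⟨hmA p, hp⟩, rfl⟩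
      · rintro ⟨⟨p', s⟩, ⟨hs, hsr⟩, rfl⟩
        exact (hm p' s hs).trans hsr
    rw [this]
    refine IsClosed.measurableSet (isClosedMap_fst_of_compactSpace _ (hA.inter ?_))
    exact isClosed_le (by fun_prop) continuous_const
  refine ⟨fun p => q (m p), measurable_subtype_coe.comp (hq.measurable.comp hmm), fun p => ?_⟩
  rw [isArgmin_iff hU hφ p (q (m p)).2]
  exact le_antisymm (cTransform_le (τ := τ) hU hφ p (q (m p)).2) (hmA p)

/-- At a point where the `c`-transform is differentiable in `v`, its gradient `2 τ (v - u)`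
determines the minimizer `u`. -/
lemma isArgmin_unique_of_differentiableAt (hτ : 0 < τ) (hU : IsCompact U) (hφ : IsPotential U φ)
    {y : Y} {v : EuclideanSpace ℝ (Fin d)}
    (hd : DifferentiableAt ℝ (fun w => cTransform τ U φ (y, w)) v)
    {u u' : EuclideanSpace ℝ (Fin d)} (hu : IsArgmin τ U φ (y, v) u)
    (hu' : IsArgmin τ U φ (y, v) u') : u = u' := by
  have key : ∀ {u}, IsArgmin τ U φ (y, v) u → ∀ w,
      fderiv ℝ (fun w => cTransform τ U φ (y, w)) v w = τ * (2 * inner ℝ (v - u) w) := by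
    intro u hu w
    have h1 : HasFDerivAt (fun w : EuclideanSpace ℝ (Fin d) => τ * ‖w - u‖ ^ 2)
        (τ • (2 • (innerSL ℝ (v - u)).comp
          (ContinuousLinearMap.id ℝ (EuclideanSpace ℝ (Fin d))))) v :=
      (((hasFDerivAt_id v).sub_const u).norm_sq).const_mul τ
    have hmin : IsLocalMin (fun w => τ * ‖w - u‖ ^ 2 - cTransform τ U φ (y, w)) v := by
      refine Eventually.of_forall fun w => ?_
      have h2 := cTransform_le (τ := τ) hU hφ (y, w) hu.1
      have h3 := cTransform_eq_of_isArgmin hu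
      simp only [qcost] at h2 h3 ⊢
      linarith
    have h0 := hmin.hasFDerivAt_eq_zero (h1.sub hd.hasFDerivAt)
    have := congrArg (fun L : EuclideanSpace ℝ (Fin d) →L[ℝ] ℝ => L w) h0
    simp only [ContinuousLinearMap.comp_id, sub_apply,
      smul_apply, innerSL_apply_apply, zero_apply,
      smul_eq_mul, nsmul_eq_mul, Nat.cast_ofNat] at this
    linarith
  have h := (key hu (u' - u)).symm.trans (key hu' (u' - u))
  have h2 : inner ℝ (v - u) (u' - u) = inner ℝ (v - u') (u' - u) := by
    have := mul_left_cancel₀ hτ.ne' h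
    linarith
  have h3 : inner ℝ (u' - u) (u' - u) = 0 := by
    have : u' - u = (v - u) - (v - u') := by abel
    conv_lhs => arg 2; rw [this]
    rw [inner_sub_left, h2, sub_self]
  rw [inner_self_eq_zero, sub_eq_zero] at h3
  exact h3.symm

/-- The `c`-transform is almost everywhere differentiable in `v`: up to the smooth function
`τ ‖v‖²` it is an infimum of affine functions with bounded slopes, hence Lipschitz. -/
lemma ae_differentiableAt_cTransform (hτ : 0 < τ) (hU : IsCompact U) (hne : U.Nonempty)
    (hφ : IsPotential U φ) (y : Y) :
    ∀ᵐ v : EuclideanSpace ℝ (Fin d), DifferentiableAt ℝ (fun w => cTransform τ U φ (y, w)) v := by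
  obtain ⟨R, hR⟩ := hU.isBounded.exists_norm_le
  have hR0 : 0 ≤ R := (norm_nonneg _).trans (hR _ hne.some_mem)
  set F : EuclideanSpace ℝ (Fin d) → ℝ := fun w => cTransform τ U φ (y, w) - τ * ‖w‖ ^ 2
  have hF : LipschitzWith (2 * τ * R).toNNReal F := by
    refine LipschitzWith.of_le_add_mul _ fun v w => ?_
    obtain ⟨u, hu⟩ := exists_isArgmin (τ := τ) hU hne hφ (y, w)
    have h1 := cTransform_le (τ := τ) hU hφ (y, v) hu.1
    have h2 := cTransform_eq_of_isArgmin hu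
    have h3 : |inner ℝ (w - v) u| ≤ dist v w * R := by
      refine (abs_real_inner_le_norm _ _).trans ?_
      rw [dist_comm, dist_eq_norm]
      exact mul_le_mul_of_nonneg_left (hR u hu.1) (norm_nonneg _)
    rw [Real.coe_toNNReal _ (by positivity)]
    simp only [qcost, norm_sub_sq_real, F] at h1 h2 ⊢
    rw [inner_sub_left] at h3
    have h4 := (abs_le.1 h3).2
    have h5 := mul_le_mul_of_nonneg_left h4 (by positivity : 0 ≤ 2 * τ)
    nlinarith
  filter_upwards [hF.ae_differentiableAt] with v hv
  have : (fun w => cTransform τ U φ (y, w)) = fun w => F w + τ * ‖w‖ ^ 2 := by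
    ext w; simp [F]
  rw [this]
  exact hv.add ((differentiableAt_id.norm_sq ℝ).const_mul τ)

end CTransform

/-! ### First-order optimality of a semi-dual potential -/

section Derivative

lemma hasDerivAt_integral_comp_add_mul {α : Type*} [MeasurableSpace α] {μ : Measure α}
    [IsFiniteMeasure μ] {F : ℝ → ℝ} (hF : Differentiable ℝ F) (hmono : Monotone F)
    (hmono' : Monotone (deriv F)) {s w : α → ℝ} (hs : AEStronglyMeasurable s μ)
    (hw : AEStronglyMeasurable w μ) {C : ℝ} (hsC : ∀ᵐ x ∂μ, |s x| ≤ C) (hwC : ∀ᵐ x ∂μ, |w x| ≤ C) :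
    HasDerivAt (fun ε : ℝ => ∫ x, F (s x + ε * w x) ∂μ) (∫ x, deriv F (s x) * w x ∂μ) 0 := by
  set D : ℝ := max |deriv F (-(2 * C))| |deriv F (2 * C)|
  have hD : 0 ≤ D := (abs_nonneg _).trans (le_max_left _ _)
  have hmeas : ∀ ε : ℝ, AEMeasurable (fun x => s x + ε * w x) μ := fun ε =>
    hs.aemeasurable.add (hw.aemeasurable.const_mul ε)
  have key := (hasDerivAt_integral_of_dominated_loc_of_deriv_le (μ := μ) (𝕜 := ℝ) (x₀ := 0)
    (F := fun ε x => F (s x + ε * w x)) (F' := fun ε x => deriv F (s x + ε * w x) * w x)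
    (bound := fun _ => D * C) (s := Metric.ball 0 1) (Metric.ball_mem_nhds _ one_pos)
    (Eventually.of_forall fun ε =>
      (hF.continuous.measurable.comp_aemeasurable (hmeas ε)).aestronglyMeasurable)
    (by simpa using hmono.integrable_comp hs hsC)
    (((measurable_deriv F).comp_aemeasurable (hmeas 0)).mul hw.aemeasurable).aestronglyMeasurable
    ?_ (integrable_const _) ?_).2
  · simpa using key
  · filter_upwards [hsC, hwC] with x h1 h2 ε hε
    have hε1 : |ε| ≤ 1 := by
      have := (mem_ball_zero_iff.1 hε).le
      rwa [Real.norm_eq_abs] at this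
    have h3 : |ε * w x| ≤ C := by
      rw [abs_mul]
      calc |ε| * |w x| ≤ 1 * C := mul_le_mul hε1 h2 (abs_nonneg _) zero_le_one
        _ = C := one_mul C
    rw [norm_mul, Real.norm_eq_abs, Real.norm_eq_abs]
    refine mul_le_mul ?_ h2 (abs_nonneg _) hD
    have h4 := abs_le.1 h1
    have h5 := abs_le.1 h3
    exact abs_le_max_abs_abs (hmono' (by linarith)) (hmono' (by linarith))
  · refine Eventually.of_forall fun x ε _ => ?_
    have h1 : HasDerivAt (fun ε : ℝ => s x + ε * w x) (w x) ε := by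
      simpa using ((hasDerivAt_id ε).mul_const (w x)).const_add (s x)
    exact (hF _).hasDerivAt.comp ε h1

end Derivative

section Potentials

variable {Y : Type*} [MetricSpace Y] {d : ℕ} {τ : ℝ} {U V : Set (EuclideanSpace ℝ (Fin d))}
  {φ : Y × EuclideanSpace ℝ (Fin d) → ℝ}

lemma IsPotential.exists_bound [CompactSpace Y] (hφ : IsPotential U φ) (hU : IsCompact U) :
    ∃ C, ∀ p : Y × EuclideanSpace ℝ (Fin d), p.2 ∈ U → |φ p| ≤ C := by
  obtain ⟨C, hC⟩ := (isCompact_univ.prod hU).exists_bound_of_continuousOn hφ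
  exact ⟨C, fun p hp => hC p ⟨mem_univ _, hp⟩⟩

variable [MeasurableSpace Y] [BorelSpace Y]

lemma IsPotential.aestronglyMeasurable (hφ : IsPotential U φ) (hU : IsCompact U)
    {ν : Measure (Y × EuclideanSpace ℝ (Fin d))} (h : ∀ᵐ p ∂ν, p.2 ∈ U) :
    AEStronglyMeasurable φ ν := by
  rw [← Measure.restrict_eq_self_of_ae_mem (s := univ ×ˢ U) (h.mono fun _ hp => ⟨mem_univ _, hp⟩)]
  exact ContinuousOn.aestronglyMeasurable hφ (isClosed_univ.prod hU.isClosed).measurableSet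

variable [CompactSpace Y]

lemma IsPotential.integrable (hφ : IsPotential U φ) (hU : IsCompact U)
    {ν : Measure (Y × EuclideanSpace ℝ (Fin d))} [IsFiniteMeasure ν] (h : ∀ᵐ p ∂ν, p.2 ∈ U) :
    Integrable φ ν := by
  obtain ⟨C, hC⟩ := hφ.exists_bound hU
  exact Integrable.of_bound (hφ.aestronglyMeasurable hU h) C (h.mono hC)

/-- The first-order optimality condition: an optimal semi-dual potential solves the Kantorovich
dual problem between the reweighted measures. It is obtained by moving from `φ` towards a
competitor; the `c`-transform is concave along this segment. -/
theorem IsOptimalPotential.dual_le {Ψ₁ Ψ₂ : ℝ≥0 → EReal} (hV : IsCompact V) (hU : IsCompact U)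
    (hne : U.Nonempty)
    (hΨ₁ : IsEntropy Ψ₁) (hΨ₂ : IsEntropy Ψ₂) (hΨ₁' : HasDiffConj Ψ₁) (hΨ₂' : HasDiffConj Ψ₂)
    {η ν : Measure (Y × EuclideanSpace ℝ (Fin d))} [IsProbabilityMeasure η]
    [IsProbabilityMeasure ν] (hηV : ∀ᵐ p ∂η, p.2 ∈ V) (hνU : ∀ᵐ p ∂ν, p.2 ∈ U)
    (hφ : IsOptimalPotential τ Ψ₁ Ψ₂ U η ν φ) {g h : Y × EuclideanSpace ℝ (Fin d) → ℝ}
    (hg : Continuous g) (hh : Continuous h)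
    (hgh : ∀ y, ∀ v ∈ V, ∀ u ∈ U, g (y, v) + h (y, u) ≤ qcost τ v u) :
    ∫ p, g p ∂(etaTilde τ Ψ₁ U η φ) + ∫ p, h p ∂(nuTilde Ψ₂ ν φ) ≤
      ∫ p, cTransform τ U φ p ∂(etaTilde τ Ψ₁ U η φ) + ∫ p, φ p ∂(nuTilde Ψ₂ ν φ) := by
  have hφc : Continuous (cTransform τ U φ) := continuous_cTransform hU hφ.1
  have hs₁ : AEStronglyMeasurable (fun p => -cTransform τ U φ p) η :=
    hφc.neg.aestronglyMeasurable
  have hs₂ : AEStronglyMeasurable (fun p => -φ p) ν := (hφ.1.aestronglyMeasurable hU hνU).neg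
  have hw₁ : Continuous fun p => -(g p - cTransform τ U φ p) := (hg.sub hφc).neg
  have hw₂ : IsPotential U fun p => -(h p - φ p) := (hh.continuousOn.sub hφ.1).neg
  obtain ⟨C₁, hC₁⟩ := (isPotential_of_continuous (U := V) hφc).exists_bound hV
  obtain ⟨C₂, hC₂⟩ := (isPotential_of_continuous (U := V) hw₁).exists_bound hV
  obtain ⟨C₃, hC₃⟩ := hφ.1.exists_bound hU
  obtain ⟨C₄, hC₄⟩ := hw₂.exists_bound hU
  have hmem₁ : ∀ᵐ p ∂η, |-cTransform τ U φ p| ≤ max C₁ C₂ ∧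
      |-(g p - cTransform τ U φ p)| ≤ max C₁ C₂ := hηV.mono fun p hp =>
    ⟨by rw [abs_neg]; exact (hC₁ p hp).trans (le_max_left _ _),
      (hC₂ p hp).trans (le_max_right _ _)⟩
  have hmem₂ : ∀ᵐ p ∂ν, |-φ p| ≤ max C₃ C₄ ∧ |-(h p - φ p)| ≤ max C₃ C₄ := hνU.mono fun p hp =>
    ⟨by rw [abs_neg]; exact (hC₃ p hp).trans (le_max_left _ _),
      (hC₄ p hp).trans (le_max_right _ _)⟩
  have hd₁ := hasDerivAt_integral_comp_add_mul hΨ₁'.2 (hΨ₁.monotone_conjReal hΨ₁')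
    (hΨ₁.monotone_deriv_conjReal hΨ₁') hs₁ hw₁.aestronglyMeasurable
    (hmem₁.mono fun _ => And.left) (hmem₁.mono fun _ => And.right)
  have hd₂ := hasDerivAt_integral_comp_add_mul hΨ₂'.2 (hΨ₂.monotone_conjReal hΨ₂')
    (hΨ₂.monotone_deriv_conjReal hΨ₂') hs₂ (hw₂.aestronglyMeasurable hU hνU)
    (hmem₂.mono fun _ => And.left) (hmem₂.mono fun _ => And.right)
  have hd := hd₁.add hd₂
  have hmin : ∀ ε ∈ Ioc (0 : ℝ) 1,
      ∫ p, conjReal Ψ₁ (-cTransform τ U φ p) ∂η + ∫ p, conjReal Ψ₂ (-φ p) ∂ν ≤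
      ∫ p, conjReal Ψ₁ (-cTransform τ U φ p + ε * -(g p - cTransform τ U φ p)) ∂η
        + ∫ p, conjReal Ψ₂ (-φ p + ε * -(h p - φ p)) ∂ν := by
    intro ε hε
    set ψ : Y × EuclideanSpace ℝ (Fin d) → ℝ := fun p => φ p + ε * (h p - φ p)
    have hψ : IsPotential U ψ := hφ.1.add (continuousOn_const.mul (hh.continuousOn.sub hφ.1))
    have hψc : Continuous (cTransform τ U ψ) := continuous_cTransform hU hψ
    have hJ := hφ.2 ψ hψ
    have hle : ∀ p : Y × EuclideanSpace ℝ (Fin d), p.2 ∈ V →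
        -cTransform τ U ψ p ≤ -cTransform τ U φ p + ε * -(g p - cTransform τ U φ p) := by
      rintro ⟨y, v⟩ hv
      obtain ⟨u, hu⟩ := exists_isArgmin (τ := τ) hU hne hψ (y, v)
      have h1 := cTransform_eq_of_isArgmin hu
      have h2 := mul_le_mul_of_nonneg_left (cTransform_le (τ := τ) hU hφ.1 (y, v) hu.1)
        (sub_nonneg.2 hε.2)
      have h3 := mul_le_mul_of_nonneg_left (hgh y v hv u hu.1) hε.1.le
      simp only [ψ] at h1 h2 h3
      simp only [ψ, h1]
      linarith
    have hi₁ : Integrable (fun p => conjReal Ψ₁ (-cTransform τ U ψ p)) η := by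
      obtain ⟨C, hC⟩ := (isPotential_of_continuous (U := V) hψc).exists_bound hV
      exact (hΨ₁.monotone_conjReal hΨ₁').integrable_comp hψc.neg.aestronglyMeasurable
        (hηV.mono fun p hp => (abs_neg (cTransform τ U ψ p)).trans_le (hC p hp))
    have hi₂ : Integrable
        (fun p => conjReal Ψ₁ (-cTransform τ U φ p + ε * -(g p - cTransform τ U φ p))) η := by
      have hc : Continuous fun p => -cTransform τ U φ p + ε * -(g p - cTransform τ U φ p) :=
        hφc.neg.add (continuous_const.mul hw₁)
      obtain ⟨C, hC⟩ := (isPotential_of_continuous (U := V) hc).exists_bound hV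
      exact (hΨ₁.monotone_conjReal hΨ₁').integrable_comp hc.aestronglyMeasurable (hηV.mono hC)
    have hmono : ∫ p, conjReal Ψ₁ (-cTransform τ U ψ p) ∂η ≤
        ∫ p, conjReal Ψ₁ (-cTransform τ U φ p + ε * -(g p - cTransform τ U φ p)) ∂η :=
      integral_mono_ae hi₁ hi₂ (hηV.mono fun p hp => hΨ₁.monotone_conjReal hΨ₁' (hle p hp))
    have heq : ∫ p, conjReal Ψ₂ (-ψ p) ∂ν = ∫ p, conjReal Ψ₂ (-φ p + ε * -(h p - φ p)) ∂ν := by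
      congr 1; ext p; congr 1; simp only [ψ]; ring
    unfold semiDual at hJ
    simp only [integral_neg] at hJ
    linarith
  have hnonneg : 0 ≤ ∫ p, deriv (conjReal Ψ₁) (-cTransform τ U φ p) *
        -(g p - cTransform τ U φ p) ∂η
      + ∫ p, deriv (conjReal Ψ₂) (-φ p) * -(h p - φ p) ∂ν := by
    refine ge_of_tendsto hd.tendsto_slope_zero_right ?_
    filter_upwards [Ioc_mem_nhdsGT one_pos] with ε hε
    have := hmin ε hε
    simp only [Pi.add_apply, zero_add, zero_mul, add_zero, smul_eq_mul]
    exact mul_nonneg (inv_nonneg.2 hε.1.le) (by linarith)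
  have he₁ := fun k => integral_conjDensity hΨ₁ hΨ₁' hs₁ k
  have he₂ := fun k => integral_conjDensity hΨ₂ hΨ₂' hs₂ k
  rw [← he₁, ← he₂] at hnonneg
  have hfin₁ := isFiniteMeasure_conjDensity hΨ₁ hΨ₁' hs₁ (hmem₁.mono fun _ => And.left)
  have hfin₂ := isFiniteMeasure_conjDensity hΨ₂ hΨ₂' hs₂ (hmem₂.mono fun _ => And.left)
  have hηV' : ∀ᵐ p ∂(conjDensity Ψ₁ η fun p => -cTransform τ U φ p), p.2 ∈ V :=
    conjDensity_ac.ae_le hηV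
  have hνU' : ∀ᵐ p ∂(conjDensity Ψ₂ ν fun p => -φ p), p.2 ∈ U := conjDensity_ac.ae_le hνU
  simp only [integral_neg] at hnonneg
  rw [integral_sub ((isPotential_of_continuous hg).integrable hV hηV')
      ((isPotential_of_continuous hφc).integrable hV hηV'),
    integral_sub ((isPotential_of_continuous hh).integrable hU hνU')
      (hφ.1.integrable hU hνU')] at hnonneg
  simp only [conjDensity] at hnonneg
  unfold etaTilde nuTilde
  linarith

end Potentials

/-! ### Wasserstein bounds and existence of plans -/

section Wasserstein

variable {d : ℕ} {τ : ℝ} {U V : Set (EuclideanSpace ℝ (Fin d))}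

lemma ofReal_integral_le_lintegral {α : Type*} [MeasurableSpace α] {μ : Measure α} {f : α → ℝ}
    (hf : Integrable f μ) : ENNReal.ofReal (∫ x, f x ∂μ) ≤ ∫⁻ x, ENNReal.ofReal (f x) ∂μ := by
  rw [integral_eq_lintegral_pos_part_sub_lintegral_neg_part hf]
  refine (ENNReal.ofReal_le_ofReal (sub_le_self _ ENNReal.toReal_nonneg)).trans ?_
  exact ENNReal.ofReal_toReal_le

lemma W2_sq {E : Type*} [NormedAddCommGroup E] [MeasurableSpace E] (α β : Measure E) :
    W2 α β ^ 2 = ⨅ γ : {γ : Measure (E × E) // γ.fst = α ∧ γ.snd = β},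
      ∫⁻ q, ENNReal.ofReal (‖q.1 - q.2‖ ^ 2) ∂γ.1 := by
  unfold W2
  rw [← ENNReal.rpow_natCast, ← ENNReal.rpow_mul]
  norm_num

lemma condW2_sq {Y : Type*} [MeasurableSpace Y] (μ : Measure Y)
    (η ν : Measure (Y × EuclideanSpace ℝ (Fin d))) [IsFiniteMeasure η] [IsFiniteMeasure ν] :
    condW2 μ η ν ^ 2 = ∫⁻ y, W2 (η.condKernel y) (ν.condKernel y) ^ 2 ∂μ := by
  unfold condW2
  rw [← ENNReal.rpow_natCast, ← ENNReal.rpow_mul]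
  norm_num

/-- The easy half of Kantorovich duality for the quadratic cost. -/
lemma ofReal_integral_add_le_W2 (hτ : 0 < τ) {α β : Measure (EuclideanSpace ℝ (Fin d))}
    (hα : ∀ᵐ v ∂α, v ∈ V) (hβ : ∀ᵐ u ∂β, u ∈ U) {g h : EuclideanSpace ℝ (Fin d) → ℝ}
    (hg : Integrable g α) (hh : Integrable h β)
    (hgh : ∀ v ∈ V, ∀ u ∈ U, g v + h u ≤ qcost τ v u) :
    ENNReal.ofReal (∫ v, g v ∂α + ∫ u, h u ∂β) ≤ ENNReal.ofReal τ * W2 α β ^ 2 := by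
  rw [W2_sq, ENNReal.mul_iInf_of_ne (by simpa using hτ) ENNReal.ofReal_ne_top]
  refine le_iInf fun γ => ?_
  obtain ⟨γ, rfl, rfl⟩ := γ
  have hg' : Integrable (fun q : EuclideanSpace ℝ (Fin d) × EuclideanSpace ℝ (Fin d) => g q.1) γ :=
    Integrable.comp_measurable hg measurable_fst
  have hh' : Integrable (fun q : EuclideanSpace ℝ (Fin d) × EuclideanSpace ℝ (Fin d) => h q.2) γ :=
    Integrable.comp_measurable hh measurable_snd
  have e1 : ∫ v, g v ∂γ.fst = ∫ q, g q.1 ∂γ :=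
    integral_map measurable_fst.aemeasurable hg.aestronglyMeasurable
  have e2 : ∫ u, h u ∂γ.snd = ∫ q, h q.2 ∂γ :=
    integral_map measurable_snd.aemeasurable hh.aestronglyMeasurable
  rw [e1, e2, ← integral_add hg' hh', ← lintegral_const_mul' _ _ ENNReal.ofReal_ne_top]
  refine (ofReal_integral_le_lintegral (hg'.add hh')).trans (lintegral_mono_ae ?_)
  filter_upwards [ae_of_ae_map measurable_fst.aemeasurable hα,
    ae_of_ae_map measurable_snd.aemeasurable hβ] with q h1 h2
  rw [← ENNReal.ofReal_mul hτ.le]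
  exact ENNReal.ofReal_le_ofReal (hgh _ h1 _ h2)

lemma ae_condKernel_mem {Y : Type*} [MeasurableSpace Y]
    {η : Measure (Y × EuclideanSpace ℝ (Fin d))} [IsFiniteMeasure η]
    {p : Y × EuclideanSpace ℝ (Fin d) → Prop} (h : ∀ᵐ q ∂η, p q) :
    ∀ᵐ y ∂η.fst, ∀ᵐ v ∂η.condKernel y, p (y, v) := by
  rw [← η.disintegrate η.condKernel] at h
  exact Measure.ae_ae_of_ae_compProd h

/-- The easy half of Kantorovich duality, integrated over the condition `y`. -/
lemma ofReal_integral_add_le_condW2 {Y : Type*} [MeasurableSpace Y] (hτ : 0 < τ)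
    {η ν : Measure (Y × EuclideanSpace ℝ (Fin d))} [IsFiniteMeasure η] [IsFiniteMeasure ν]
    (hην : η.fst = ν.fst) (hηV : ∀ᵐ p ∂η, p.2 ∈ V) (hνU : ∀ᵐ p ∂ν, p.2 ∈ U)
    {g h : Y × EuclideanSpace ℝ (Fin d) → ℝ} (hg : Integrable g η) (hh : Integrable h ν)
    (hgh : ∀ y, ∀ v ∈ V, ∀ u ∈ U, g (y, v) + h (y, u) ≤ qcost τ v u) :
    ENNReal.ofReal (∫ p, g p ∂η + ∫ p, h p ∂ν) ≤ ENNReal.ofReal τ * condW2 ν.fst η ν ^ 2 := by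
  rw [condW2_sq, ← lintegral_const_mul' _ _ ENNReal.ofReal_ne_top,
    ← Measure.integral_condKernel hg, ← Measure.integral_condKernel hh]
  have i1 : Integrable (fun y => ∫ v, g (y, v) ∂η.condKernel y) ν.fst :=
    hην ▸ hg.integral_condKernel
  have i2 : Integrable (fun y => ∫ v, h (y, v) ∂ν.condKernel y) ν.fst := hh.integral_condKernel
  rw [hην, ← integral_add i1 i2]
  refine (ofReal_integral_le_lintegral (i1.add i2)).trans (lintegral_mono_ae ?_)
  have a1 := hην ▸ ae_condKernel_mem hηV
  have a2 := hην ▸ hg.condKernel_ae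
  filter_upwards [a1, ae_condKernel_mem hνU, a2, hh.condKernel_ae] with y h1 h2 h3 h4
  exact ofReal_integral_add_le_W2 hτ h1 h2 h3 h4 (hgh y)

end Wasserstein

section Plans

variable {Y : Type*} [MetricSpace Y] [CompactSpace Y] [MeasurableSpace Y] [BorelSpace Y] {d : ℕ}
  {τ : ℝ} {U V : Set (EuclideanSpace ℝ (Fin d))}

/-- Kantorovich duality for plans on the diagonal `y = y'`: the fibre product
`Y × V × U` of `Y × V` and `Y × U` over `Y` is compact. -/
theorem exists_plan_of_dual_le (hV : IsCompact V) (hU : IsCompact U) {μ : Measure Y}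
    (α β : Measure (Y × EuclideanSpace ℝ (Fin d))) [IsFiniteMeasure α] [IsFiniteMeasure β]
    (hα : α.fst ≪ μ) (B : ℝ)
    (hB : ∀ g h : Y × EuclideanSpace ℝ (Fin d) → ℝ, Continuous g → Continuous h →
      (∀ y, ∀ v ∈ V, ∀ u ∈ U, g (y, v) + h (y, u) ≤ qcost τ v u) →
      ∫ p, g p ∂α + ∫ p, h p ∂β ≤ B) :
    ∃ π : Measure ((Y × EuclideanSpace ℝ (Fin d)) × (Y × EuclideanSpace ℝ (Fin d))),
      IsPlan μ V U π ∧ π.fst = α ∧ π.snd = β ∧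
      ∫ q, qcost τ q.1.2 q.2.2 ∂π ≤ B := by
  have := isCompact_iff_compactSpace.1 hV
  have := isCompact_iff_compactSpace.1 hU
  set a : Y × V × U → Y × EuclideanSpace ℝ (Fin d) := fun k => (k.1, k.2.1)
  set b : Y × V × U → Y × EuclideanSpace ℝ (Fin d) := fun k => (k.1, k.2.2)
  have ha : Continuous a := by fun_prop
  have hb : Continuous b := by fun_prop
  have hab : Measurable fun k => (a k, b k) := (ha.prodMk hb).measurable
  have hc : Continuous fun k : Y × V × U => qcost τ (a k).2 (b k).2 :=
    ha.snd.qcost hb.snd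
  let c : C(Y × V × U, ℝ) := ⟨fun k => qcost τ (a k).2 (b k).2, hc⟩
  obtain ⟨m, hm, hma, hmb, hmc⟩ := exists_coupling_of_dual_le ha hb α β c B fun g h hgh => by
    refine hB g h g.continuous h.continuous fun y v hv u hu => ?_
    have h1 : c (y, ⟨v, hv⟩, ⟨u, hu⟩) = qcost τ v u := rfl
    rw [← h1]
    exact hgh (y, ⟨v, hv⟩, ⟨u, hu⟩)
  have hfst : (m.map fun k => (a k, b k)).fst = α := by
    rw [Measure.fst_map_prodMk hb.measurable, hma]
  refine ⟨m.map fun k => (a k, b k), ⟨inferInstance, ?_, ?_, ?_, ?_⟩, hfst, ?_, ?_⟩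
  · refine (ae_map_iff hab.aemeasurable ?_).2 (Eventually.of_forall fun k => rfl)
    exact (isClosed_eq (by fun_prop) (by fun_prop)).measurableSet
  · refine (ae_map_iff hab.aemeasurable ?_).2 (Eventually.of_forall fun k => k.2.1.2)
    exact (hV.isClosed.preimage (by fun_prop)).measurableSet
  · refine (ae_map_iff hab.aemeasurable ?_).2 (Eventually.of_forall fun k => k.2.2.2)
    exact (hU.isClosed.preimage (by fun_prop)).measurableSet
  · rwa [hfst]
  · rw [Measure.snd_map_prodMk ha.measurable, hmb]
  · rw [integral_map hab.aemeasurable]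
    · exact hmc
    · exact (continuous_fst.snd.qcost continuous_snd.snd).aestronglyMeasurable

end Plans

/-! ### Complementary slackness -/

section PlanDuality

variable {Y : Type*} {d : ℕ} {τ : ℝ} {U V : Set (EuclideanSpace ℝ (Fin d))}
  {φ : Y × EuclideanSpace ℝ (Fin d) → ℝ} {Ψ₁ Ψ₂ : ℝ≥0 → EReal}

/-- The slack `c(v, u) - φ^c(y, v) - φ(y', u)` in the dual constraint. It is nonnegative where
`y = y'`, and then it vanishes exactly if `u` is a minimizer. -/
noncomputable def slack (τ : ℝ) (U : Set (EuclideanSpace ℝ (Fin d)))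
    (φ : Y × EuclideanSpace ℝ (Fin d) → ℝ)
    (q : (Y × EuclideanSpace ℝ (Fin d)) × (Y × EuclideanSpace ℝ (Fin d))) : ℝ :=
  qcost τ q.1.2 q.2.2 - cTransform τ U φ q.1 - φ q.2

variable [MeasurableSpace Y] {η ν : Measure (Y × EuclideanSpace ℝ (Fin d))} {μ : Measure Y}
  {π : Measure ((Y × EuclideanSpace ℝ (Fin d)) × (Y × EuclideanSpace ℝ (Fin d)))}

lemma IsPlan.snd_fst (hπ : IsPlan μ V U π) : π.snd.fst = π.fst.fst := by
  unfold Measure.fst Measure.snd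
  rw [Measure.map_map measurable_fst measurable_snd, Measure.map_map measurable_fst measurable_fst]
  exact Measure.map_congr (hπ.diag.mono fun _ h => h.symm)

lemma condDiv_add_le_cuotObjective [IsFiniteMeasure η] [IsFiniteMeasure ν]
    (hην : η.fst = ν.fst)
    (π : Measure ((Y × EuclideanSpace ℝ (Fin d)) × (Y × EuclideanSpace ℝ (Fin d))))
    [IsFiniteMeasure π] :
    condDiv Ψ₁ ν.fst π.fst η + condDiv Ψ₂ ν.fst π.snd ν ≤ cuotObjective τ Ψ₁ Ψ₂ η ν π := by
  unfold cuotObjective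
  rw [hην]
  gcongr
  exact le_add_of_nonneg_left (EReal.coe_ennreal_nonneg _)

variable [MetricSpace Y]

lemma IsPlan.slack_nonneg (hπ : IsPlan μ V U π) (hU : IsCompact U) (hφ : IsPotential U φ) :
    ∀ᵐ q ∂π, 0 ≤ slack τ U φ q := by
  filter_upwards [hπ.diag, hπ.target] with q h1 h2
  have := cTransform_le (τ := τ) hU hφ q.1 h2
  rw [h1] at this
  unfold slack
  linarith

/-- The minimizers are the points where the slack vanishes. -/
lemma IsPlan.ae_isArgmin (hπ : IsPlan μ V U π) (hU : IsCompact U) (hφ : IsPotential U φ)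
    (h0 : ∀ᵐ q ∂π, slack τ U φ q = 0) : ∀ᵐ q ∂π, IsArgmin τ U φ q.1 q.2.2 := by
  filter_upwards [h0, hπ.diag, hπ.target] with q h1 h2 h3
  rw [isArgmin_iff hU hφ q.1 h3, h2]
  unfold slack at h1
  linarith

/-- Under complementary slackness with unique minimizers, a plan is induced by the selection of
minimizers. -/
lemma IsPlan.eq_map_tri (hπ : IsPlan μ V U π) (hU : IsCompact U)
    (hφ : IsPotential U φ) (h0 : ∀ᵐ q ∂π, slack τ U φ q = 0)
    (huniq : ∀ᵐ p ∂π.fst, ∀ u u', IsArgmin τ U φ p u → IsArgmin τ U φ p u' → u = u')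
    {T : Y × EuclideanSpace ℝ (Fin d) → EuclideanSpace ℝ (Fin d)} (hT : Measurable T)
    (hTmin : ∀ p, IsArgmin τ U φ p (T p)) : π = π.fst.map fun p => (p, tri T p) := by
  have hm : Measurable fun p => (p, tri T p) := measurable_id.prodMk (measurable_fst.prodMk hT)
  have hae : (fun q => (q.1, tri T q.1)) =ᵐ[π] id := by
    filter_upwards [hπ.ae_isArgmin hU hφ h0, ae_of_ae_map measurable_fst.aemeasurable huniq,
      hπ.diag] with q h1 h2 h3
    exact Prod.ext rfl (Prod.ext h3 (h2 _ _ (hTmin q.1) h1))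
  unfold Measure.fst
  rw [Measure.map_map hm measurable_fst]
  exact (Measure.map_id.symm.trans (Measure.map_congr hae).symm)

variable [BorelSpace Y]

lemma IsPlan.ae_fst_mem (hπ : IsPlan μ V U π) (hV : IsCompact V) : ∀ᵐ p ∂π.fst, p.2 ∈ V :=
  (ae_map_iff measurable_fst.aemeasurable
    (hV.isClosed.preimage continuous_snd).measurableSet).2 hπ.source

lemma IsPlan.ae_snd_mem (hπ : IsPlan μ V U π) (hU : IsCompact U) : ∀ᵐ p ∂π.snd, p.2 ∈ U :=
  (ae_map_iff measurable_snd.aemeasurable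
    (hU.isClosed.preimage continuous_snd).measurableSet).2 hπ.target

variable [CompactSpace Y]

lemma IsPlan.integrable_qcost [IsFiniteMeasure π] (hπ : IsPlan μ V U π) (hV : IsCompact V)
    (hU : IsCompact U) : Integrable (fun q => qcost τ q.1.2 q.2.2) π := by
  have hc : Continuous fun q : (Y × EuclideanSpace ℝ (Fin d)) × (Y × EuclideanSpace ℝ (Fin d)) =>
      qcost τ q.1.2 q.2.2 := continuous_fst.snd.qcost continuous_snd.snd
  obtain ⟨C, hC⟩ := ((isCompact_univ (X := Y)).prod hV |>.prod
    ((isCompact_univ (X := Y)).prod hU)).exists_bound_of_continuousOn hc.continuousOn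
  refine Integrable.of_bound hc.aestronglyMeasurable C ?_
  filter_upwards [hπ.source, hπ.target] with q h1 h2
  exact hC q ⟨⟨mem_univ _, h1⟩, ⟨mem_univ _, h2⟩⟩

lemma IsPlan.lintegral_qcost [IsFiniteMeasure π] (hπ : IsPlan μ V U π) (hτ : 0 ≤ τ)
    (hV : IsCompact V) (hU : IsCompact U) :
    ((∫⁻ q, ENNReal.ofReal (qcost τ q.1.2 q.2.2) ∂π : ℝ≥0∞) : EReal)
      = ((∫ q, qcost τ q.1.2 q.2.2 ∂π : ℝ) : EReal) := by
  have h0 : ∀ q : (Y × EuclideanSpace ℝ (Fin d)) × (Y × EuclideanSpace ℝ (Fin d)),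
      0 ≤ qcost τ q.1.2 q.2.2 := fun q => qcost_nonneg hτ _ _
  rw [← ofReal_integral_eq_lintegral_ofReal (hπ.integrable_qcost hV hU) (Eventually.of_forall h0),
    EReal.coe_ennreal_ofReal, max_eq_left (integral_nonneg h0)]

lemma IsPlan.integrable_slack_and_integral_qcost [IsFiniteMeasure π] (hπ : IsPlan μ V U π)
    (hV : IsCompact V) (hU : IsCompact U) (hφ : IsPotential U φ) :
    Integrable (slack τ U φ) π ∧ ∫ q, qcost τ q.1.2 q.2.2 ∂π =
      ∫ q, slack τ U φ q ∂π + ∫ p, cTransform τ U φ p ∂π.fst + ∫ p, φ p ∂π.snd := by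
  have hφc := continuous_cTransform (τ := τ) hU hφ
  have i1 : Integrable (cTransform τ U φ) π.fst :=
    (isPotential_of_continuous hφc).integrable hV (hπ.ae_fst_mem hV)
  have i2 : Integrable φ π.snd := hφ.integrable hU (hπ.ae_snd_mem hU)
  have j1 : Integrable (fun q : (Y × EuclideanSpace ℝ (Fin d)) × (Y × EuclideanSpace ℝ (Fin d)) =>
      cTransform τ U φ q.1) π := 
    Integrable.comp_measurable (g := cTransform τ U φ) i1 measurable_fst
  have j2 : Integrable (fun q : (Y × EuclideanSpace ℝ (Fin d)) × (Y × EuclideanSpace ℝ (Fin d)) =>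
      φ q.2) π := Integrable.comp_measurable (g := φ) i2 measurable_snd
  have jc := hπ.integrable_qcost (τ := τ) hV hU
  have e1 : ∫ p, cTransform τ U φ p ∂π.fst = ∫ q, cTransform τ U φ q.1 ∂π :=
    integral_map measurable_fst.aemeasurable i1.aestronglyMeasurable
  have e2 : ∫ p, φ p ∂π.snd = ∫ q, φ q.2 ∂π :=
    integral_map measurable_snd.aemeasurable i2.aestronglyMeasurable
  refine ⟨(jc.sub j1).sub j2, ?_⟩
  unfold slack
  rw [integral_sub (jc.sub' j1) j2, integral_sub jc j1, e1, e2]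
  ring

/-- Regularity of the two arguments of the conjugates in the semi-dual objective. -/
lemma IsPotential.exists_bounds (hV : IsCompact V) (hU : IsCompact U) (hφ : IsPotential U φ)
    (hηV : ∀ᵐ p ∂η, p.2 ∈ V) (hνU : ∀ᵐ p ∂ν, p.2 ∈ U) :
    AEStronglyMeasurable (fun p => -cTransform τ U φ p) η ∧
    AEStronglyMeasurable (fun p => -φ p) ν ∧
    ∃ C, (∀ᵐ p ∂η, |-cTransform τ U φ p| ≤ C) ∧ ∀ᵐ p ∂ν, |-φ p| ≤ C := by
  have hφc : Continuous (cTransform τ U φ) := continuous_cTransform hU hφ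
  obtain ⟨C₁, hC₁⟩ := (isPotential_of_continuous (U := V) hφc).exists_bound hV
  obtain ⟨C₂, hC₂⟩ := hφ.exists_bound hU
  refine ⟨hφc.neg.aestronglyMeasurable, (hφ.aestronglyMeasurable hU hνU).neg, max C₁ C₂,
    hηV.mono fun p hp => ?_, hνU.mono fun p hp => ?_⟩
  · rw [abs_neg]; exact (hC₁ p hp).trans (le_max_left _ _)
  · rw [abs_neg]; exact (hC₂ p hp).trans (le_max_right _ _)

variable [IsProbabilityMeasure η] [IsProbabilityMeasure ν] [IsFiniteMeasure π]

/-- Weak duality, with the equality case: a plan whose objective is the semi-dual value of `φ`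
has the reweighted measures as marginals and is concentrated where the slack vanishes. -/
theorem IsPlan.semiDual_le (hτ : 0 ≤ τ) (hV : IsCompact V) (hU : IsCompact U)
    (hΨ₁ : IsEntropy Ψ₁) (hΨ₂ : IsEntropy Ψ₂) (hΨ₁' : HasDiffConj Ψ₁) (hΨ₂' : HasDiffConj Ψ₂)
    (hηV : ∀ᵐ p ∂η, p.2 ∈ V) (hνU : ∀ᵐ p ∂ν, p.2 ∈ U) (hην : η.fst = ν.fst)
    (hφ : IsPotential U φ) (hπ : IsPlan η.fst V U π)
    (hfin : cuotObjective τ Ψ₁ Ψ₂ η ν π ≠ ⊤) :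
    ((semiDual τ Ψ₁ Ψ₂ U η ν φ : ℝ) : EReal) ≤ cuotObjective τ Ψ₁ Ψ₂ η ν π ∧
      (cuotObjective τ Ψ₁ Ψ₂ η ν π = ((semiDual τ Ψ₁ Ψ₂ U η ν φ : ℝ) : EReal) →
        π.fst = etaTilde τ Ψ₁ U η φ ∧ π.snd = nuTilde Ψ₂ ν φ ∧
        ∀ᵐ q ∂π, slack τ U φ q = 0) := by
  obtain ⟨hs₁, hs₂, C, hC₁, hC₂⟩ := hφ.exists_bounds (τ := τ) hV hU hηV hνU
  obtain ⟨hsl, hc⟩ := hπ.integrable_slack_and_integral_qcost (τ := τ) hV hU hφ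
  have hsl0 := hπ.slack_nonneg (τ := τ) hU hφ
  have hbot₁ : condDiv Ψ₁ η.fst π.fst η ≠ ⊥ :=
    ((EReal.bot_lt_coe _).trans_le (neg_le_condDiv hΨ₁ hΨ₁' _ _)).ne'
  have hbot₂ : condDiv Ψ₂ ν.fst π.snd ν ≠ ⊥ :=
    ((EReal.bot_lt_coe _).trans_le (neg_le_condDiv hΨ₂ hΨ₂' _ _)).ne'
  unfold cuotObjective at hfin ⊢
  rw [hπ.lintegral_qcost hτ hV hU] at hfin ⊢
  have hfin₂ : condDiv Ψ₂ ν.fst π.snd ν ≠ ⊤ := fun h => hfin <| by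
    rw [h]
    refine EReal.add_top_of_ne_bot fun hb => ?_
    rcases EReal.add_eq_bot_iff.1 hb with hb | hb
    · exact EReal.coe_ne_bot _ hb
    · exact hbot₁ hb
  have hfin₁ : condDiv Ψ₁ η.fst π.fst η ≠ ⊤ := fun h => hfin <| by
    rw [h, EReal.coe_add_top]
    exact EReal.top_add_of_ne_bot hbot₂
  obtain ⟨-, r₁, hr₁, hle₁, heq₁⟩ :=
    fenchel_young_condDiv hΨ₁ hΨ₁' hπ.marginal hfin₁ hs₁ hC₁
  obtain ⟨-, r₂, hr₂, hle₂, heq₂⟩ :=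
    fenchel_young_condDiv hΨ₂ hΨ₂' (hπ.snd_fst ▸ hην ▸ hπ.marginal) hfin₂ hs₂ hC₂
  have hint := integral_nonneg_of_ae hsl0
  simp only [integral_neg] at hle₁ hle₂ heq₁ heq₂
  rw [hr₁, hr₂, ← EReal.coe_add, ← EReal.coe_add, EReal.coe_le_coe_iff, EReal.coe_eq_coe_iff]
  unfold semiDual
  simp only [integral_neg]
  refine ⟨by linarith, fun heq => ⟨heq₁ (by linarith), heq₂ (by linarith), ?_⟩⟩
  exact (integral_eq_zero_iff_of_nonneg_ae hsl0 hsl).1 (by linarith)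

/-- Strong duality for plans that satisfy the complementary slackness conditions. -/
theorem IsPlan.cuotObjective_eq_semiDual (hτ : 0 ≤ τ) (hV : IsCompact V) (hU : IsCompact U)
    (hΨ₁ : IsEntropy Ψ₁) (hΨ₂ : IsEntropy Ψ₂) (hΨ₁' : HasDiffConj Ψ₁) (hΨ₂' : HasDiffConj Ψ₂)
    (hηV : ∀ᵐ p ∂η, p.2 ∈ V) (hνU : ∀ᵐ p ∂ν, p.2 ∈ U)
    (hφ : IsPotential U φ) (hπ : IsPlan η.fst V U π)
    (h₁ : π.fst = etaTilde τ Ψ₁ U η φ) (h₂ : π.snd = nuTilde Ψ₂ ν φ)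
    (h0 : ∫ q, slack τ U φ q ∂π = 0) :
    cuotObjective τ Ψ₁ Ψ₂ η ν π = ((semiDual τ Ψ₁ Ψ₂ U η ν φ : ℝ) : EReal) := by
  obtain ⟨hs₁, hs₂, C, hC₁, hC₂⟩ := hφ.exists_bounds (τ := τ) hV hU hηV hνU
  obtain ⟨-, hc⟩ := hπ.integrable_slack_and_integral_qcost (τ := τ) hV hU hφ
  unfold cuotObjective
  rw [hπ.lintegral_qcost hτ hV hU, condDiv_conjDensity hΨ₁ hΨ₁' hs₁ hC₁ h₁,
    condDiv_conjDensity hΨ₂ hΨ₂' hs₂ hC₂ h₂, ← EReal.coe_add, ← EReal.coe_add,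
    EReal.coe_eq_coe_iff]
  unfold semiDual
  simp only [integral_neg]
  linarith

end PlanDuality

/-! ### Optimal plans -/

section OptimalPlans

variable {Y : Type*} [MetricSpace Y] [MeasurableSpace Y] [BorelSpace Y] [CompactSpace Y] {d : ℕ}
  {τ : ℝ} {U V : Set (EuclideanSpace ℝ (Fin d))} {φ : Y × EuclideanSpace ℝ (Fin d) → ℝ}
  {Ψ₁ Ψ₂ : ℝ≥0 → EReal} {η ν : Measure (Y × EuclideanSpace ℝ (Fin d))} {μ : Measure Y}

/-- A triangular map that transports `α` to `β` induces a plan with these marginals. -/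
lemma isPlan_map_tri (hV : IsCompact V) (hU : IsCompact U)
    {α β : Measure (Y × EuclideanSpace ℝ (Fin d))} [IsFiniteMeasure α] (hα : α.fst ≪ μ)
    (hαV : ∀ᵐ p ∂α, p.2 ∈ V) (hβU : ∀ᵐ p ∂β, p.2 ∈ U)
    {S : Y × EuclideanSpace ℝ (Fin d) → EuclideanSpace ℝ (Fin d)} (hS : Measurable S)
    (hSβ : α.map (tri S) = β) :
    IsPlan μ V U (α.map fun p => (p, tri S p)) ∧
      (α.map fun p => (p, tri S p)).fst = α ∧ (α.map fun p => (p, tri S p)).snd = β ∧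
      ∫⁻ q, ENNReal.ofReal (qcost τ q.1.2 q.2.2) ∂(α.map fun p => (p, tri S p))
        = ∫⁻ p, ENNReal.ofReal (qcost τ p.2 (S p)) ∂α := by
  have htri : Measurable (tri S) := measurable_fst.prodMk hS
  have hm : Measurable fun p => (p, tri S p) := measurable_id.prodMk htri
  have hfst : (α.map fun p => (p, tri S p)).fst = α := by
    rw [Measure.fst_map_prodMk htri, Measure.map_id']
  have hc : Measurable fun q : (Y × EuclideanSpace ℝ (Fin d)) × (Y × EuclideanSpace ℝ (Fin d)) =>
      ENNReal.ofReal (qcost τ q.1.2 q.2.2) :=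
    (continuous_fst.snd.qcost continuous_snd.snd).measurable.ennreal_ofReal
  refine ⟨⟨inferInstance, ?_, ?_, ?_, ?_⟩, hfst, ?_, lintegral_map hc hm⟩
  · refine (ae_map_iff hm.aemeasurable ?_).2 (Eventually.of_forall fun p => rfl)
    exact (isClosed_eq (by fun_prop) (by fun_prop)).measurableSet
  · exact (ae_map_iff hm.aemeasurable (hV.isClosed.preimage (by fun_prop)).measurableSet).2 hαV
  · refine (ae_map_iff hm.aemeasurable (hU.isClosed.preimage (by fun_prop)).measurableSet).2 ?_
    rw [← hSβ] at hβU
    exact ae_of_ae_map htri.aemeasurable hβU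
  · rwa [hfst]
  · rw [Measure.snd_map_prodMk measurable_id', hSβ]

/-- If the source conditionals have densities, the minimizers are almost surely unique. -/
lemma ae_isArgmin_unique (hτ : 0 < τ) (hU : IsCompact U) (hne : U.Nonempty) (hφ : IsPotential U φ)
    [IsFiniteMeasure η] (hη : ∀ᵐ y ∂η.fst, η.condKernel y ≪ volume) :
    ∀ᵐ p ∂η, ∀ u u', IsArgmin τ U φ p u → IsArgmin τ U φ p u' → u = u' := by
  have hφc : Continuous (cTransform τ U φ) := continuous_cTransform hU hφ
  have hD : MeasurableSet {p : Y × EuclideanSpace ℝ (Fin d) |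
      DifferentiableAt ℝ (fun w => cTransform τ U φ (p.1, w)) p.2} :=
    measurableSet_of_differentiableAt_with_param ℝ
      (f := fun (y : Y) (w : EuclideanSpace ℝ (Fin d)) => cTransform τ U φ (y, w)) hφc
  have hae : ∀ᵐ p ∂η, DifferentiableAt ℝ (fun w => cTransform τ U φ (p.1, w)) p.2 := by
    rw [← η.disintegrate η.condKernel]
    refine (Measure.ae_compProd_iff hD).2 ?_
    filter_upwards [hη] with y hy
    exact hy.ae_le (ae_differentiableAt_cTransform hτ hU hne hφ y)
  filter_upwards [hae] with p hp u u' hu hu'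
  exact isArgmin_unique_of_differentiableAt hτ hU hφ hp hu hu'

variable [IsProbabilityMeasure η] [IsProbabilityMeasure ν]

/-- An optimal potential admits a plan that satisfies the complementary slackness conditions. -/
lemma IsOptimalPotential.exists_plan (hV : IsCompact V) (hU : IsCompact U)
    (hne : U.Nonempty)
    (hΨ₁ : IsEntropy Ψ₁) (hΨ₂ : IsEntropy Ψ₂) (hΨ₁' : HasDiffConj Ψ₁) (hΨ₂' : HasDiffConj Ψ₂)
    (hηV : ∀ᵐ p ∂η, p.2 ∈ V) (hνU : ∀ᵐ p ∂ν, p.2 ∈ U)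
    (hφ : IsOptimalPotential τ Ψ₁ Ψ₂ U η ν φ) :
    ∃ π : Measure ((Y × EuclideanSpace ℝ (Fin d)) × (Y × EuclideanSpace ℝ (Fin d))),
      IsPlan η.fst V U π ∧ π.fst = etaTilde τ Ψ₁ U η φ ∧ π.snd = nuTilde Ψ₂ ν φ ∧
      ∫ q, slack τ U φ q ∂π = 0 := by
  obtain ⟨hs₁, hs₂, C, hC₁, hC₂⟩ := hφ.1.exists_bounds (τ := τ) hV hU hηV hνU
  have hf₁ : IsFiniteMeasure (etaTilde τ Ψ₁ U η φ) :=
    isFiniteMeasure_conjDensity hΨ₁ hΨ₁' hs₁ hC₁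
  have hf₂ : IsFiniteMeasure (nuTilde Ψ₂ ν φ) := isFiniteMeasure_conjDensity hΨ₂ hΨ₂' hs₂ hC₂
  have hac : etaTilde τ Ψ₁ U η φ ≪ η := withDensity_absolutelyContinuous _ _
  obtain ⟨π, hπ, h₁, h₂, hc⟩ := exists_plan_of_dual_le (τ := τ) hV hU (μ := η.fst)
    (etaTilde τ Ψ₁ U η φ) (nuTilde Ψ₂ ν φ) (hac.map measurable_fst)
    (∫ p, cTransform τ U φ p ∂(etaTilde τ Ψ₁ U η φ) + ∫ p, φ p ∂(nuTilde Ψ₂ ν φ))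
    fun g h hg hh hgh => hφ.dual_le hV hU hne hΨ₁ hΨ₂ hΨ₁' hΨ₂' hηV hνU hg hh hgh
  have := hπ.finite
  obtain ⟨-, hc'⟩ := hπ.integrable_slack_and_integral_qcost (τ := τ) hV hU hφ.1
  rw [h₁, h₂] at hc'
  refine ⟨π, hπ, h₁, h₂, le_antisymm (by linarith) ?_⟩
  exact integral_nonneg_of_ae (hπ.slack_nonneg hU hφ.1)

/-- The semi-dual value is at most the transport cost between the original measures, as
`s ≤ Ψ*(s)`. -/
lemma semiDual_le_condW2 (hτ : 0 < τ) (hV : IsCompact V) (hU : IsCompact U)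
    (hΨ₁ : IsEntropy Ψ₁) (hΨ₂ : IsEntropy Ψ₂) (hΨ₁' : HasDiffConj Ψ₁) (hΨ₂' : HasDiffConj Ψ₂)
    (hηV : ∀ᵐ p ∂η, p.2 ∈ V) (hνU : ∀ᵐ p ∂ν, p.2 ∈ U) (hην : η.fst = ν.fst)
    (hφ : IsPotential U φ) :
    ((semiDual τ Ψ₁ Ψ₂ U η ν φ : ℝ) : EReal)
      ≤ ((ENNReal.ofReal τ * condW2 ν.fst η ν ^ 2 : ℝ≥0∞) : EReal) := by
  obtain ⟨hs₁, hs₂, C, hC₁, hC₂⟩ := hφ.exists_bounds (τ := τ) hV hU hηV hνU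
  have i₁ : Integrable (cTransform τ U φ) η :=
    (isPotential_of_continuous (continuous_cTransform hU hφ)).integrable hV hηV
  have i₂ : Integrable φ ν := hφ.integrable hU hνU
  have hW := ofReal_integral_add_le_condW2 hτ hην hηV hνU i₁ i₂ fun y v _ u hu => by
    have := cTransform_le (τ := τ) hU hφ (y, v) hu
    simp only at this
    linarith
  refine le_trans ?_ (EReal.coe_ennreal_le_coe_ennreal_iff.2 hW)
  rw [EReal.coe_ennreal_ofReal, EReal.coe_le_coe_iff]
  refine le_trans ?_ (le_max_left _ _)
  unfold semiDual
  refine add_le_add (integral_mono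
    ((hΨ₁.monotone_conjReal hΨ₁').integrable_comp hs₁ hC₁).neg i₁ fun p => ?_)
    (integral_mono ((hΨ₂.monotone_conjReal hΨ₂').integrable_comp hs₂ hC₂).neg i₂ fun p => ?_)
  · have := hΨ₁.le_conjReal hΨ₁' (-cTransform τ U φ p)
    linarith
  · have := hΨ₂.le_conjReal hΨ₂' (-φ p)
    linarith

/-- By Kantorovich duality, some plan with the original measures as marginals has cost at most
the squared conditional Wasserstein distance, and its divergence terms vanish. -/
lemma exists_plan_cuotObjective_le_condW2 (hτ : 0 < τ) (hV : IsCompact V) (hU : IsCompact U)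
    (hΨ₁ : IsEntropy Ψ₁) (hΨ₂ : IsEntropy Ψ₂) (hΨ₁' : HasDiffConj Ψ₁) (hΨ₂' : HasDiffConj Ψ₂)
    (hηV : ∀ᵐ p ∂η, p.2 ∈ V) (hνU : ∀ᵐ p ∂ν, p.2 ∈ U) (hην : η.fst = ν.fst)
    (hfin : ENNReal.ofReal τ * condW2 ν.fst η ν ^ 2 ≠ ∞) :
    ∃ (π : Measure ((Y × EuclideanSpace ℝ (Fin d)) × (Y × EuclideanSpace ℝ (Fin d))))
      (_ : IsFiniteMeasure π), IsPlan η.fst V U π ∧ π.fst = η ∧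
      cuotObjective τ Ψ₁ Ψ₂ η ν π
        ≤ ((ENNReal.ofReal τ * condW2 ν.fst η ν ^ 2 : ℝ≥0∞) : EReal) := by
  obtain ⟨π, hπ, h₁, h₂, hc⟩ := exists_plan_of_dual_le (τ := τ) hV hU (μ := η.fst) η ν
    Measure.AbsolutelyContinuous.rfl (ENNReal.ofReal τ * condW2 ν.fst η ν ^ 2).toReal
    fun g h hg hh hgh => (ENNReal.ofReal_le_iff_le_toReal hfin).1 <|
      ofReal_integral_add_le_condW2 hτ hην hηV hνU
        ((isPotential_of_continuous hg).integrable hV hηV)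
        ((isPotential_of_continuous hh).integrable hU hνU) hgh
  have hπf := hπ.finite
  refine ⟨π, hπf, hπ, h₁, ?_⟩
  unfold cuotObjective
  simp only [h₁, h₂]
  rw [hπ.lintegral_qcost hτ.le hV hU, condDiv_self hΨ₁ hΨ₁', condDiv_self hΨ₂ hΨ₂', add_zero,
    add_zero, ← EReal.coe_ennreal_toReal hfin, EReal.coe_le_coe_iff]
  exact hc

end OptimalPlans

/-! ### Transport maps and the divergence bound -/

theorem theorem3 {Y : Type*} [MetricSpace Y] [CompactSpace Y] [MeasurableSpace Y] [BorelSpace Y]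
    {d : ℕ} (V U : Set (EuclideanSpace ℝ (Fin d))) (hV : IsCompact V) (hU : IsCompact U)
    (τ : ℝ) (hτ : 0 < τ)
    (Ψ₁ Ψ₂ : ℝ≥0 → EReal) (hΨ₁ : IsEntropy Ψ₁) (hΨ₂ : IsEntropy Ψ₂)
    (hΨ₁' : HasDiffConj Ψ₁) (hΨ₂' : HasDiffConj Ψ₂)
    (η ν : Measure (Y × EuclideanSpace ℝ (Fin d)))
    [IsProbabilityMeasure η] [IsProbabilityMeasure ν]
    (hηV : ∀ᵐ p ∂η, p.2 ∈ V) (hνU : ∀ᵐ p ∂ν, p.2 ∈ U) (hην : η.fst = ν.fst)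
    (φ : Y × EuclideanSpace ℝ (Fin d) → ℝ) (hφ : IsOptimalPotential τ Ψ₁ Ψ₂ U η ν φ) :
    -- a measurable triangular map that selects minimizers; it is the optimal transport map and
    -- induces the optimal plan as soon as the source conditionals have densities
    (∃ T : Y × EuclideanSpace ℝ (Fin d) → EuclideanSpace ℝ (Fin d),
      Measurable T ∧ (∀ p, T p ∈ U) ∧
      (∀ᵐ p ∂η, IsArgmin τ U φ p (T p)) ∧
      (∀ᵐ p ∂η, cTransform τ U φ p = qcost τ p.2 (T p) - φ (p.1, T p)) ∧
      ((∀ᵐ y ∂η.fst, η.condKernel y ≪ volume) →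
        IsMongeOptimal τ (etaTilde τ Ψ₁ U η φ) (nuTilde Ψ₂ ν φ) T ∧
        ∀ (π : Measure ((Y × EuclideanSpace ℝ (Fin d)) × (Y × EuclideanSpace ℝ (Fin d))))
          [IsFiniteMeasure π], IsOptimalPlan τ Ψ₁ Ψ₂ V U η ν π →
          π = (etaTilde τ Ψ₁ U η φ).map (fun p => (p, tri T p)))) ∧
    -- the conditional `c`-transform of every potential is parameterized by a triangular map
    (∀ ψ, IsPotential U ψ →
      (∀ p u, u ∈ U →
        (IsArgmin τ U ψ p u ↔ cTransform τ U ψ p = qcost τ p.2 u - ψ (p.1, u))) ∧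
      ∃ S : Y × EuclideanSpace ℝ (Fin d) → EuclideanSpace ℝ (Fin d),
        Measurable S ∧ (∀ p, S p ∈ U) ∧
        ∀ᵐ p ∂η, cTransform τ U ψ p = qcost τ p.2 (S p) - ψ (p.1, S p)) ∧
    -- an optimal plan exists
    (∃ (π : Measure ((Y × EuclideanSpace ℝ (Fin d)) × (Y × EuclideanSpace ℝ (Fin d))))
      (_ : IsFiniteMeasure π), IsOptimalPlan τ Ψ₁ Ψ₂ V U η ν π) ∧
    -- every optimal plan has the explicit marginals and satisfies the divergence bound, and if it
    -- is induced by a triangular map, then this map selects minimizers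
    (∀ (π : Measure ((Y × EuclideanSpace ℝ (Fin d)) × (Y × EuclideanSpace ℝ (Fin d))))
      [IsFiniteMeasure π], IsOptimalPlan τ Ψ₁ Ψ₂ V U η ν π →
      π.fst = etaTilde τ Ψ₁ U η φ ∧ π.snd = nuTilde Ψ₂ ν φ ∧
      condDiv Ψ₁ ν.fst π.fst η + condDiv Ψ₂ ν.fst π.snd ν
        ≤ ((ENNReal.ofReal τ * condW2 ν.fst η ν ^ 2 : ℝ≥0∞) : EReal) ∧
      ∀ S : Y × EuclideanSpace ℝ (Fin d) → EuclideanSpace ℝ (Fin d), Measurable S →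
        π = π.fst.map (fun p => (p, tri S p)) → ∀ᵐ p ∂π.fst, IsArgmin τ U φ p (S p)) ∧
    -- the divergence bound for plans that are optimal under the constraint `π_Y = η_Y`
    (∀ (π : Measure ((Y × EuclideanSpace ℝ (Fin d)) × (Y × EuclideanSpace ℝ (Fin d))))
      [IsFiniteMeasure π], IsOptimalBalancedPlan τ Ψ₁ Ψ₂ V U η ν π →
      condDiv Ψ₁ ν.fst π.fst η + condDiv Ψ₂ ν.fst π.snd ν
        ≤ ((ENNReal.ofReal τ * condW2 ν.fst η ν ^ 2 : ℝ≥0∞) : EReal)) := by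
  have hne : U.Nonempty := let ⟨p, hp⟩ := hνU.exists; ⟨p.2, hp⟩
  obtain ⟨T, hT, hTmin⟩ := exists_measurable_isArgmin (τ := τ) hU hne hφ.1
  obtain ⟨π₀, hπ₀, hπ₀fst, hπ₀snd, hsl₀⟩ :=
    hφ.exists_plan hV hU hne hΨ₁ hΨ₂ hΨ₁' hΨ₂' hηV hνU
  have hfin₀ := hπ₀.finite
  have hobj₀ := hπ₀.cuotObjective_eq_semiDual hτ.le hV hU hΨ₁ hΨ₂ hΨ₁' hΨ₂' hηV hνU hφ.1
    hπ₀fst hπ₀snd hsl₀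
  have hopt₀ : IsOptimalPlan τ Ψ₁ Ψ₂ V U η ν π₀ := by
    refine ⟨hπ₀, fun π' _ hπ' => ?_⟩
    rw [hobj₀]
    by_cases htop : cuotObjective τ Ψ₁ Ψ₂ η ν π' = ⊤
    · exact htop ▸ le_top
    · exact (hπ'.semiDual_le hτ.le hV hU hΨ₁ hΨ₂ hΨ₁' hΨ₂' hηV hνU hην hφ.1 htop).1
  -- every optimal plan attains the semi-dual value, hence satisfies complementary slackness
  have hslack : ∀ (π : Measure ((Y × EuclideanSpace ℝ (Fin d)) × (Y × EuclideanSpace ℝ (Fin d))))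
      [IsFiniteMeasure π], IsOptimalPlan τ Ψ₁ Ψ₂ V U η ν π →
      cuotObjective τ Ψ₁ Ψ₂ η ν π = ((semiDual τ Ψ₁ Ψ₂ U η ν φ : ℝ) : EReal) ∧
      π.fst = etaTilde τ Ψ₁ U η φ ∧ π.snd = nuTilde Ψ₂ ν φ ∧ ∀ᵐ q ∂π, slack τ U φ q = 0 := by
    intro π _ hπ
    have hle := hobj₀ ▸ hπ.2 π₀ hπ₀
    have hw := hπ.1.semiDual_le hτ.le hV hU hΨ₁ hΨ₂ hΨ₁' hΨ₂' hηV hνU hην hφ.1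
      (hle.trans_lt (EReal.coe_lt_top _)).ne
    have heq := le_antisymm hle hw.1
    exact ⟨heq, hw.2 heq⟩
  have hac : etaTilde τ Ψ₁ U η φ ≪ η := withDensity_absolutelyContinuous _ _
  refine ⟨⟨T, hT, fun p => (hTmin p).1, Eventually.of_forall hTmin,
    Eventually.of_forall fun p => cTransform_eq_of_isArgmin (hTmin p), fun hη => ?_⟩,
    fun ψ hψ => ⟨fun p u hu => isArgmin_iff hU hψ p hu, ?_⟩, ⟨π₀, hfin₀, hopt₀⟩,
    fun π _ hπ => ?_, fun π _ hπ => ?_⟩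
  · have huniq := ae_isArgmin_unique hτ hU hne hφ.1 hη
    have hmap : ∀ (π : Measure ((Y × EuclideanSpace ℝ (Fin d)) ×
        (Y × EuclideanSpace ℝ (Fin d)))) [IsFiniteMeasure π], IsOptimalPlan τ Ψ₁ Ψ₂ V U η ν π →
        π = (etaTilde τ Ψ₁ U η φ).map (fun p => (p, tri T p)) := by
      intro π _ hπ
      obtain ⟨-, h₁, -, h0⟩ := hslack π hπ
      have := hπ.1.eq_map_tri hU hφ.1 h0 (h₁ ▸ hac.ae_le huniq) hT hTmin
      rwa [h₁] at this
    have hTν : (etaTilde τ Ψ₁ U η φ).map (tri T) = nuTilde Ψ₂ ν φ := by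
      rw [← hπ₀snd, hmap π₀ hopt₀, Measure.snd_map_prodMk measurable_id']
    refine ⟨⟨⟨hT, hTν⟩, fun S hS hSν => ?_⟩, hmap⟩
    have hηfin : IsFiniteMeasure (etaTilde τ Ψ₁ U η φ) := hπ₀fst ▸ inferInstance
    have hνac : nuTilde Ψ₂ ν φ ≪ ν := withDensity_absolutelyContinuous _ _
    obtain ⟨-, -, -, hTc⟩ := isPlan_map_tri (τ := τ) hV hU (hac.map measurable_fst)
      (hac.ae_le hηV) (hνac.ae_le hνU) hT hTν
    obtain ⟨hpS, hS₁, hS₂, hSc⟩ := isPlan_map_tri (τ := τ) hV hU (hac.map measurable_fst)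
      (hac.ae_le hηV) (hνac.ae_le hνU) hS hSν
    -- both costs are the common dual value plus the integral of the slack, which vanishes for `T`
    obtain ⟨-, cT⟩ := hπ₀.integrable_slack_and_integral_qcost (τ := τ) hV hU hφ.1
    obtain ⟨-, cS⟩ := hpS.integrable_slack_and_integral_qcost (τ := τ) hV hU hφ.1
    have hS0 := integral_nonneg_of_ae (hpS.slack_nonneg (τ := τ) hU hφ.1)
    rw [hS₁, hS₂] at cS
    rw [hsl₀, hπ₀fst, hπ₀snd] at cT
    rw [← hTc, ← hSc, ← EReal.coe_ennreal_le_coe_ennreal_iff, ← hmap π₀ hopt₀,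
      hπ₀.lintegral_qcost hτ.le hV hU, hpS.lintegral_qcost hτ.le hV hU, EReal.coe_le_coe_iff]
    linarith
  · obtain ⟨S, hS, hSmin⟩ := exists_measurable_isArgmin (τ := τ) hU hne hψ
    exact ⟨S, hS, fun p => (hSmin p).1,
      Eventually.of_forall fun p => cTransform_eq_of_isArgmin (hSmin p)⟩
  · obtain ⟨hobj, h₁, h₂, h0⟩ := hslack π hπ
    refine ⟨h₁, h₂, ?_, fun S hS hSπ => ?_⟩
    · refine (condDiv_add_le_cuotObjective (τ := τ) hην π).trans ?_
      rw [hobj]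
      exact semiDual_le_condW2 hτ hV hU hΨ₁ hΨ₂ hΨ₁' hΨ₂' hηV hνU hην hφ.1
    · have hmin := hπ.1.ae_isArgmin hU hφ.1 h0
      rw [hSπ] at hmin
      exact ae_of_ae_map
        (measurable_id.prodMk (measurable_fst.prodMk hS : Measurable (tri S))).aemeasurable hmin
  · by_cases htop : ENNReal.ofReal τ * condW2 ν.fst η ν ^ 2 = ∞
    · rw [htop]
      exact le_top
    · obtain ⟨π', hπ'f, hπ', hfst, hle⟩ := exists_plan_cuotObjective_le_condW2 hτ hV hU
        hΨ₁ hΨ₂ hΨ₁' hΨ₂' hηV hνU hην htop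
      exact (condDiv_add_le_cuotObjective (τ := τ) hην π).trans
        ((hπ.2 π' hπ' (by rw [hfst])).trans hle)
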